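/- Consider real single-input single-output bilinear systems $\zeta=(A,N,b,c)$ of dimension $n$, $\dot x=Ax+uNx+ub$, $y=cx$, with $A,N\in\mathbb R^{n\times n}$ and $b,c^{T}\in\mathbb R^{n}$. The transfer function of order $k\ge 1$ of $\zeta$ is $$H_k(s_1,\dots,s_k)=c\,(s_kI-A)^{-1}N(s_{k-1}I-A)^{-1}N\cdots N(s_1I-A)^{-1}b .$$ For a sequence $F=(F_k)_{k\ge1}$ of functions $F_k$ of $k$ complex variables put $$\|F\|_{\mathcal H_2}=\Big(\sum_{k=1}^{\infty}\ \sup_{x_1,\dots,x_k>0}\frac1{(2\pi)^k}\int_{\mathbb R^k}|F_k(x_1+iy_1,\dots,x_k+iy_k)|^2\,dy\Big)^{1/2}\in[0,\infty],$$ and write $\|\zeta\|_{\mathcal H_2}=\|(H_k)_k\|_{\mathcal H_2}$ and $\|\zeta-\tilde\zeta\|_{\mathcal H_2}=\|(H_k-\tilde H_k)_k\|_{\mathcal H_2}$. A system is stable if all eigenvalues of its matrix $A$ have negative real part. **Theorem.** Let $\zeta$ be a stable system of dimension $n$ with $\|\zeta\|_{\mathcal H_2}<\infty$. Let $\tilde\zeta=(\tilde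 A,\tilde N,\tilde b,\tilde c)$ be a stable system of dimension $r$, with transfer functions $\tilde H_k$, such that $\tilde A$ has $r$ distinct eigenvalues $\tilde\lambda_1,\dots,\tilde\lambda_r\in\mathbb C$. Suppose that $\tilde\zeta$ is a (locally) $\mathcal H_2$-optimal approximation of $\zeta$ of dimension $r$: $\|\tilde\zeta\|_{\mathcal H_2}<\infty$ and $\|\zeta-\tilde\zeta\|_{\mathcal H_2}\le\|\zeta-\eta\|_{\mathcal H_2}$ for all systems $\eta$ of dimension $r$ with $\|\eta\|_{\mathcal H_2}<\infty$ whose matrices lie in some neighbourhood of those of $\tilde\zeta$ (in particular, $\tilde\zeta$ may be a global minimizer). For $l_1,\dots,l_k\in\{1,\dots,r\}$ let $$\tilde\phi_{l_1,\dots,l_k}=\lim_{s_k\to\tilde\lambda_{l_k}}(s_k-\tilde\lambda_{l_k})\cdots\lim_{s_1\to\tilde\lambda_{l_1}}(s_1-\tilde\lambda_{l_1})\,\tilde H_k(s_1,\dots,s_k)$$ be the residues of $\tilde H_k$. Then $$\sum_{k=1}^{\infty}\sum_{l_1=1}^{r}\cdots\sum_{l_k=1}^{r}\tilde\phi_{l_1,\dots,l_k}H_k(-\tilde\lambda_{l_1},\dots,-\tilde\lambda_{l_k})=\sum_{k=1}^{\infty}\sum_{l_1=1}^{r}\cdots\sum_{l_k=1}^{r}\tilde\phi_{l_1,\dots,l_k}\tilde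 H_k(-\tilde\lambda_{l_1},\dots,-\tilde\lambda_{l_k})$$ and $$\sum_{k=1}^{\infty}\sum_{l_1=1}^{r}\cdots\sum_{l_k=1}^{r}\tilde\phi_{l_1,\dots,l_k}\sum_{j=1}^{k}\frac{\partial H_k}{\partial s_j}(-\tilde\lambda_{l_1},\dots,-\tilde\lambda_{l_k})=\sum_{k=1}^{\infty}\sum_{l_1=1}^{r}\cdots\sum_{l_k=1}^{r}\tilde\phi_{l_1,\dots,l_k}\sum_{j=1}^{k}\frac{\partial\tilde H_k}{\partial s_j}(-\tilde\lambda_{l_1},\dots,-\tilde\lambda_{l_k}),$$ where all four series over $k$ converge absolutely (the $k$-th term being the finite sum over $l_1,\dots,l_k$). -/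

import Mathlib

open Filter Topology MeasureTheory
open scoped ENNReal Matrix

/-- A real single-input single-output bilinear system of dimension `n`:
`x' = A x + u N x + u b`, `y = c x`. -/
structure BilinearSystem (n : ℕ) where
  A : Matrix (Fin n) (Fin n) ℝ
  N : Matrix (Fin n) (Fin n) ℝ
  b : Fin n → ℝ
  c : Fin n → ℝ

/-- A family of transfer functions: the member with index `k` has order `k + 1`, that is, it depends
on the variables `s₁, …, s_{k+1}`, stored as `s 0, …, s k`. -/
abbrev TransferFamily : Type := (k : ℕ) → (Fin (k + 1) → ℂ) → ℂ

namespace BilinearSystem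

/-- The usual topology on realizations, that of the entries of `(A, N, b, c)`. -/
instance instTopologicalSpace (n : ℕ) : TopologicalSpace (BilinearSystem n) :=
  TopologicalSpace.induced (fun ζ => (ζ.A, ζ.N, ζ.b, ζ.c)) inferInstance

variable {n : ℕ}

/-- The matrix `A`, with complex entries. -/
noncomputable def Ac (ζ : BilinearSystem n) : Matrix (Fin n) (Fin n) ℂ :=
  ζ.A.map (fun x : ℝ => (x : ℂ))

/-- The matrix `N`, with complex entries. -/
noncomputable def Nc (ζ : BilinearSystem n) : Matrix (Fin n) (Fin n) ℂ :=
  ζ.N.map (fun x : ℝ => (x : ℂ))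

/-- The resolvent `(s I - A)⁻¹`. -/
noncomputable def resolv (ζ : BilinearSystem n) (s : ℂ) : Matrix (Fin n) (Fin n) ℂ :=
  (s • (1 : Matrix (Fin n) (Fin n) ℂ) - ζ.Ac)⁻¹

/-- The vector `(s_{k+1} I - A)⁻¹ N (s_k I - A)⁻¹ N ⋯ N (s₁ I - A)⁻¹ b`. -/
noncomputable def inputToState (ζ : BilinearSystem n) :
    (k : ℕ) → (Fin (k + 1) → ℂ) → (Fin n → ℂ)
  | 0, s => ζ.resolv (s 0) *ᵥ (fun i => (ζ.b i : ℂ))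
  | k + 1, s =>
      ζ.resolv (s (Fin.last (k + 1))) *ᵥ (ζ.Nc *ᵥ inputToState ζ k (Fin.init s))

/-- The transfer functions of a bilinear system; the one of order `k + 1` is
`c (s_{k+1} I - A)⁻¹ N (s_k I - A)⁻¹ N ⋯ N (s₁ I - A)⁻¹ b`. -/
noncomputable def transfer (ζ : BilinearSystem n) : TransferFamily :=
  fun k s => (fun i => (ζ.c i : ℂ)) ⬝ᵥ ζ.inputToState k s

/-- Asymptotic stability: all eigenvalues of `A` lie in the open left half-plane. -/
def IsStable (ζ : BilinearSystem n) : Prop :=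
  ∀ z : ℂ, ζ.Ac.charpoly.IsRoot z → z.re < 0

/-- `lam` lists the zeros of `Q(s) = det (s I - A)`, and all of them are simple. -/
def HasSimplePoles (ζ : BilinearSystem n) (lam : Fin n → ℂ) : Prop :=
  Function.Injective lam ∧
    ζ.Ac.charpoly = ∏ i, (Polynomial.X - Polynomial.C (lam i))

end BilinearSystem

/-- The `H₂` norm of a family of transfer functions, as an extended nonnegative real:
the square root of `∑ₖ sup_{x₁, …, xₖ > 0} (2π)⁻ᵏ ∫ |Hₖ(x₁ + i y₁, …, xₖ + i yₖ)|² dy`. -/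
noncomputable def h2Norm (F : TransferFamily) : ℝ≥0∞ :=
  (∑' k : ℕ, ⨆ x : {x : Fin (k + 1) → ℝ // ∀ i, 0 < x i},
    (ENNReal.ofReal ((2 * Real.pi) ^ (k + 1)))⁻¹ *
      ∫⁻ y : Fin (k + 1) → ℝ,
        ‖F k (fun i => (x.1 i : ℂ) + (y i : ℂ) * Complex.I)‖ₑ ^ 2) ^ (1 / 2 : ℝ)

/-- `ζr` is a locally `H₂`-optimal approximation of `ζ` among the systems of its dimension: it has
finite `H₂` norm and minimizes the `H₂` norm of the error system (the system with transfer functions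
`Hₖ - H̃ₖ`) over all systems of finite `H₂` norm in some neighbourhood of it. A global minimizer is
in particular a local one. -/
def IsLocallyH2Optimal {n r : ℕ} (ζ : BilinearSystem n) (ζr : BilinearSystem r) : Prop :=
  h2Norm ζr.transfer < ⊤ ∧
    IsLocalMinOn (fun η : BilinearSystem r => h2Norm (ζ.transfer - η.transfer))
      {η : BilinearSystem r | h2Norm η.transfer < ⊤} ζr

/-- The iterated limit
`lim_{sₖ → μₖ} (sₖ - μₖ) ⋯ lim_{s₁ → μ₁} (s₁ - μ₁) F(s₁, …, sₖ)`,
in which the limit in the first variable is the innermost one. -/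
noncomputable def iteratedResidue : (k : ℕ) → ((Fin k → ℂ) → ℂ) → (Fin k → ℂ) → ℂ
  | 0, F, μ => F μ
  | k + 1, F, μ =>
      iteratedResidue k
        (fun t : Fin k → ℂ =>
          limUnder (𝓝[≠] (μ 0)) (fun z : ℂ => (z - μ 0) * F (Fin.cons z t : Fin (k + 1) → ℂ)))
        (Fin.tail μ)

/-- The residue `φ_{l₁, …, l_{k+1}}` of the transfer function of order `k + 1` at the tuple of
poles `(lam l₁, …, lam l_{k+1})`. -/
noncomputable def BilinearSystem.residue {n : ℕ} (ζ : BilinearSystem n) (lam : Fin n → ℂ) (k : ℕ)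
    (l : Fin (k + 1) → Fin n) : ℂ :=
  iteratedResidue (k + 1) (ζ.transfer k) (fun i => lam (l i))

/-- The partial derivative `∂F/∂sⱼ` at the point `s`. -/
noncomputable def partialDeriv {k : ℕ} (F : (Fin k → ℂ) → ℂ) (j : Fin k) (s : Fin k → ℂ) : ℂ :=
  deriv (fun z : ℂ => F (Function.update s j z)) (s j)

/-! Two one-parameter perturbations of the reduced system suffice: scaling the output by `1 + κ` and
replacing `A` by `A + t I`. Together they turn H̃ₖ(s) into (1 + κ) H̃ₖ(s₁ - t, …, sₖ - t). Transfer
functions of stable systems are Hardy functions on the right poly-half-plane, so each supremum in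
the H₂ norm is an L² norm on the imaginary axes (`IsHardy.iSup_lintegral_vertical`). There,
conjugation is evaluation at mirrored points, since the systems are real. The partial fraction
expansion of H̃ₖ is a sum of products of Cauchy kernels weighted by the residues. The Cauchy formula
(`IsHardy.integral_mul_prod_inv_sub`) therefore turns the inner product of Hₖ with the perturbed H̃ₖ
into (1 + κ) ∑ φ̃ₗ Hₖ(-λₗ - t).

Summed over k, the squared error is ‖ζ‖² - 2(1 + κ) Φ(t) + (1 + κ)² Ψ(2t), where Φ and Ψ pair the
residues with ζ and with ζ̃ at shifted points. Stationarity in κ gives Φ(0) = Ψ(0); stationarity in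
t gives Φ'(0) = Ψ'(0), where d/dt produces the sum of the partial derivatives up to sign.

The difficulty is that a shift must keep the norm finite and the series over k must be
differentiable term by term; mere summability of the energies leaves no room for this. Two facts
provide it. The energies of H̃ₖ come from a fixed finite-dimensional linear recursion, so, tending
to zero, they decay like ρᵏ with ρ < 1 (`exists_geometric_bound`, `exists_axisNormSq_le`). A small
shift costs at most a factor qᵏ, with q > 1 as close to 1 as desired and the size of the shift
independent of k and of the residues (`exists_lintegral_poleSum_shift_le`). Taking qρ < 1 yields a
summable majorant for all small complex t, and Weierstrass' theorem applies. -/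

/-! ### Cauchy and Poisson formulas on the right half-plane -/

open Complex in
/-- Cauchy's theorem on the imaginary axis for functions of quadratic decay. -/
theorem integral_imaginaryAxis_eq_zero {f : ℂ → ℂ} (hd : ∀ z : ℂ, 0 ≤ z.re → DifferentiableAt ℂ f z)
    {C R : ℝ} (hb : ∀ z : ℂ, 0 ≤ z.re → R ≤ ‖z‖ → ‖f z‖ ≤ C / ‖z‖ ^ 2)
    (hi : Integrable (fun y : ℝ => f (y * I))) : ∫ y : ℝ, f (y * I) = 0 := by
  have h1 : Tendsto (fun K : ℝ => ∫ y in (-K)..K, f (y * I)) atTop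
      (𝓝 (∫ y : ℝ, f (y * I))) :=
    intervalIntegral_tendsto_integral hi tendsto_neg_atTop_atBot tendsto_id
  refine tendsto_nhds_unique h1 ?_
  -- The other three sides of the rectangle [0, K] × [-K, K] have total length 4K, and `f` is at
  -- most C / K² on them.
  have h2 : Tendsto (fun K : ℝ => 4 * C / K) atTop (𝓝 0) := tendsto_const_nhds.div_atTop tendsto_id
  refine squeeze_zero_norm' ?_ h2
  filter_upwards [eventually_ge_atTop (max R 1)] with K hK
  have hR : R ≤ K := (le_max_left _ _).trans hK
  have hK1 : 1 ≤ K := (le_max_right _ _).trans hK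
  have hK0 : 0 < K := by linarith
  have hC : 0 ≤ C := by
    have h := hb (K : ℂ) (by simpa using hK0.le) (by simpa [abs_of_pos hK0] using hR)
    have h' := (norm_nonneg _).trans h
    have : 0 < ‖(K : ℂ)‖ ^ 2 := by simpa using by positivity
    by_contra hneg
    exact absurd h' (not_le.2 (div_neg_of_neg_of_pos (not_le.1 hneg) this))
  have hbK : ∀ z : ℂ, 0 ≤ z.re → K ≤ ‖z‖ → ‖f z‖ ≤ C / K ^ 2 := fun z hz hKz =>
    (hb z hz (hR.trans hKz)).trans (by gcongr)
  have hrect := Complex.integral_boundary_rect_eq_zero_of_differentiableOn f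
    ((-K : ℝ) * I) (K + K * I) (by
      intro z hz
      refine (hd z ?_).differentiableWithinAt
      have := hz.1
      simp [Set.uIcc_of_le hK0.le] at this
      exact this.1)
  simp only [mul_re, ofReal_re, I_re, mul_zero, ofReal_im, I_im, mul_one, sub_self, mul_im,
    add_zero, add_re, add_im, zero_add, ofReal_zero] at hrect
  set A := ∫ x in (0 : ℝ)..K, f (x + (-K : ℝ) * I) with hA
  set B := ∫ x in (0 : ℝ)..K, f (x + K * I) with hB
  set D := ∫ y in (-K)..K, f (K + y * I) with hD
  set J := ∫ y in (-K)..K, f (y * I) with hJ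
  have hAn : ‖A‖ ≤ C / K ^ 2 * |K - 0| := by
    refine intervalIntegral.norm_integral_le_of_norm_le_const fun x hx => ?_
    rw [Set.uIoc_of_le hK0.le] at hx
    refine hbK _ (by simpa using hx.1.le) ?_
    refine le_trans ?_ (Complex.abs_im_le_norm _)
    simp [abs_of_pos hK0]
  have hBn : ‖B‖ ≤ C / K ^ 2 * |K - 0| := by
    refine intervalIntegral.norm_integral_le_of_norm_le_const fun x hx => ?_
    rw [Set.uIoc_of_le hK0.le] at hx
    refine hbK _ (by simpa using hx.1.le) ?_
    refine le_trans ?_ (Complex.abs_im_le_norm _)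
    simp [abs_of_pos hK0]
  have hDn : ‖D‖ ≤ C / K ^ 2 * |K - (-K)| := by
    refine intervalIntegral.norm_integral_le_of_norm_le_const fun x hx => ?_
    refine hbK _ (by simpa using hK0.le) ?_
    refine le_trans ?_ (Complex.abs_re_le_norm _)
    simp [abs_of_pos hK0]
  have hJe : I • J = A - B + I • D := by linear_combination -hrect
  have hJn : ‖J‖ = ‖A - B + I • D‖ := by
    rw [← hJe, norm_smul, norm_I, one_mul]
  rw [hJn]
  have h3 : ‖A - B + I • D‖ ≤ ‖A‖ + ‖B‖ + ‖D‖ := by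
    refine (norm_add_le _ _).trans ?_
    rw [norm_smul, norm_I, one_mul]
    gcongr
    exact norm_sub_le _ _
  refine h3.trans ?_
  have e1 : |K - 0| = K := by rw [sub_zero, abs_of_pos hK0]
  have e2 : |K - (-K)| = 2 * K := by rw [sub_neg_eq_add, ← two_mul, abs_of_pos (by linarith)]
  rw [e1] at hAn hBn
  rw [e2] at hDn
  have : 4 * C / K = C / K ^ 2 * K + C / K ^ 2 * K + C / K ^ 2 * (2 * K) := by
    field_simp; ring
  linarith

theorem norm_inv_add_le {w z : ℂ} (hw : 0 < w.re) (hz : 0 ≤ z.re) :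
    ‖(z + w)⁻¹‖ ≤ ((1 + ‖w‖) / w.re + 1) * (1 + ‖z‖)⁻¹ := by
  have h1 : w.re ≤ ‖z + w‖ := by
    refine le_trans ?_ (Complex.re_le_norm _)
    simpa using hz
  have h2 : ‖z‖ ≤ ‖z + w‖ + ‖w‖ := by
    simpa using norm_sub_le (z + w) w
  have h3 : 0 < ‖z + w‖ := hw.trans_le h1
  have h0 : 0 < 1 + ‖z‖ := by positivity
  rw [norm_inv, ← div_eq_mul_inv, le_div_iff₀ h0, inv_mul_le_iff₀ h3]
  have h4 : 1 + ‖w‖ ≤ ‖z + w‖ * ((1 + ‖w‖) / w.re) := by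
    rw [mul_div_assoc', le_div_iff₀ hw, mul_comm]
    gcongr
  linarith

theorem integrable_of_norm_le_inv_sq {E : Type*} [NormedAddCommGroup E] {h : ℝ → E}
    (hc : Continuous h) {C : ℝ} (hb : ∀ y, ‖h y‖ ≤ C * ((1 + |y|)⁻¹ * (1 + |y|)⁻¹)) :
    Integrable h := by
  have h1 : Integrable (fun y : ℝ => C * (1 + y ^ 2)⁻¹) := integrable_inv_one_add_sq.const_mul C
  refine h1.mono' hc.aestronglyMeasurable (ae_of_all _ fun y => (hb y).trans ?_)
  have hC : 0 ≤ C := by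
    have := (norm_nonneg _).trans (hb 0)
    simpa using this
  refine mul_le_mul_of_nonneg_left ?_ hC
  rw [← mul_inv]
  refine inv_anti₀ (by positivity) ?_
  nlinarith [abs_nonneg y, sq_abs y]

theorem integrable_inv_sq : Integrable (fun y : ℝ => (1 + |y|)⁻¹ * (1 + |y|)⁻¹) :=
  integrable_of_norm_le_inv_sq (C := 1) (by
    have : ∀ y : ℝ, 1 + |y| ≠ 0 := fun y => by positivity
    fun_prop (disch := exact this _)) (fun y => by
      rw [one_mul, Real.norm_of_nonneg (by positivity)])

/-- Functions of one variable that are holomorphic on the closed right half-plane and decay like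
`1 / |z|` there. -/
structure IsHardyOne (f : ℂ → ℂ) : Prop where
  differentiableAt : ∀ z : ℂ, 0 ≤ z.re → DifferentiableAt ℂ f z
  bound : ∃ C, ∀ z : ℂ, 0 ≤ z.re → ‖f z‖ ≤ C * (1 + ‖z‖)⁻¹

namespace IsHardyOne

variable {f : ℂ → ℂ}

theorem continuous_axis (hf : IsHardyOne f) {x : ℝ} (hx : 0 ≤ x) :
    Continuous (fun y : ℝ => f (x + y * Complex.I)) := by
  rw [continuous_iff_continuousAt]
  intro y
  have h := (hf.differentiableAt (x + y * Complex.I) (by simpa using hx)).continuousAt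
  exact ContinuousAt.comp (f := fun y : ℝ => (x + y * Complex.I : ℂ)) h (by fun_prop)

theorem continuous_axis_zero (hf : IsHardyOne f) :
    Continuous (fun y : ℝ => f (y * Complex.I)) := by
  simpa using hf.continuous_axis le_rfl

theorem inv_add {w : ℂ} (hw : 0 < w.re) : IsHardyOne (fun z => (z + w)⁻¹) := by
  refine ⟨fun z hz => ?_, _, fun z hz => norm_inv_add_le hw hz⟩
  have : z + w ≠ 0 := fun h => by
    have := congrArg Complex.re h
    simp at this
    linarith
  exact DifferentiableAt.fun_inv (by fun_prop) this

theorem const_mul (hf : IsHardyOne f) (c : ℂ) : IsHardyOne (fun z => c * f z) := by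
  obtain ⟨C, hC⟩ := hf.bound
  refine ⟨fun z hz => (hf.differentiableAt z hz).const_mul c, ‖c‖ * C, fun z hz => ?_⟩
  rw [norm_mul, mul_assoc]
  gcongr
  exact hC z hz

theorem sub {g : ℂ → ℂ} (hf : IsHardyOne f) (hg : IsHardyOne g) :
    IsHardyOne (fun z => f z - g z) := by
  obtain ⟨C, hC⟩ := hf.bound
  obtain ⟨D, hD⟩ := hg.bound
  refine ⟨fun z hz => (hf.differentiableAt z hz).fun_sub (hg.differentiableAt z hz), C + D,
    fun z hz => (norm_sub_le _ _).trans ?_⟩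
  rw [add_mul]
  exact add_le_add (hC z hz) (hD z hz)

theorem integrable_mul {h : ℝ → ℂ} (hf : IsHardyOne f) (hh : Continuous h) {D : ℝ}
    (hD : ∀ y, ‖h y‖ ≤ D * (1 + |y|)⁻¹) :
    Integrable (fun y : ℝ => f (y * Complex.I) * h y) := by
  obtain ⟨C, hC⟩ := hf.bound
  refine integrable_of_norm_le_inv_sq (C := C * D) (hf.continuous_axis_zero.mul hh) fun y => ?_
  have h1 := hC (y * Complex.I) (by simp)
  have h2 := hD y
  rw [norm_mul]
  simp only [norm_mul, Complex.norm_I, mul_one, Complex.norm_real, Real.norm_eq_abs] at h1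
  calc _ ≤ (C * (1 + |y|)⁻¹) * (D * (1 + |y|)⁻¹) :=
        mul_le_mul h1 h2 (norm_nonneg _) ((norm_nonneg _).trans h1)
    _ = _ := by ring

theorem continuous_inv_sub {μ : ℂ} (hμ : 0 < μ.re) :
    Continuous (fun y : ℝ => (μ - y * Complex.I)⁻¹) := by
  refine Continuous.inv₀ (by fun_prop) fun y h => ?_
  have := congrArg Complex.re h
  simp at this
  linarith

theorem norm_inv_sub_le {μ : ℂ} (hμ : 0 < μ.re) (y : ℝ) :
    ‖(μ - y * Complex.I)⁻¹‖ ≤ ((1 + ‖μ‖) / μ.re + 1) * (1 + |y|)⁻¹ := by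
  have := norm_inv_add_le (z := -(y * Complex.I)) hμ (by simp)
  rw [neg_add_eq_sub] at this
  simpa using this

theorem integrable_mul_inv_sub (hf : IsHardyOne f) {μ : ℂ} (hμ : 0 < μ.re) :
    Integrable (fun y : ℝ => f (y * Complex.I) * (μ - y * Complex.I)⁻¹) :=
  hf.integrable_mul (continuous_inv_sub hμ) (norm_inv_sub_le hμ)

theorem integrable_mul_inv_add (hf : IsHardyOne f) {w : ℂ} (hw : 0 < w.re) :
    Integrable (fun y : ℝ => f (y * Complex.I) * (y * Complex.I + w)⁻¹) :=
  hf.integrable_mul (inv_add hw).continuous_axis_zero fun y => by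
    simpa using norm_inv_add_le (z := y * Complex.I) hw (by simp)

/-- The kernel has its pole at `-w`, in the left half-plane, and the product of two functions of
decay 1 / |z| decays quadratically, so Cauchy's theorem applies. -/
theorem integral_mul_inv_add (hf : IsHardyOne f) {w : ℂ} (hw : 0 < w.re) :
    ∫ y : ℝ, f (y * Complex.I) * (y * Complex.I + w)⁻¹ = 0 := by
  obtain ⟨C, hC⟩ := hf.bound
  obtain ⟨D, hD⟩ := (inv_add hw).bound
  refine integral_imaginaryAxis_eq_zero (f := fun z => f z * (z + w)⁻¹) (C := C * D) (R := 1)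
    (fun z hz => (hf.differentiableAt z hz).mul ((inv_add hw).differentiableAt z hz))
    (fun z hz hz1 => ?_) (hf.integrable_mul_inv_add hw)
  rw [norm_mul]
  have h1 := hC z hz
  have h2 := hD z hz
  have hCD : 0 ≤ C * D := by
    have a := (norm_nonneg _).trans (hC 0 le_rfl)
    have b := (norm_nonneg _).trans (hD 0 le_rfl)
    simp only [norm_zero, add_zero, inv_one, mul_one] at a b
    positivity
  calc _ ≤ (C * (1 + ‖z‖)⁻¹) * (D * (1 + ‖z‖)⁻¹) :=
        mul_le_mul h1 h2 (norm_nonneg _) ((norm_nonneg _).trans h1)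
    _ = C * D / (1 + ‖z‖) ^ 2 := by field_simp
    _ ≤ _ := by
      gcongr
      linarith

theorem integral_poissonKernel {μ : ℂ} (hμ : 0 < μ.re) :
    ∫ y : ℝ, μ.re / (μ.re ^ 2 + (y - μ.im) ^ 2) = Real.pi := by
  have h := integral_univ_inv_one_add_sq
  have h2 := Measure.integral_comp_mul_left (fun u : ℝ => (1 + u ^ 2)⁻¹) (μ.re⁻¹)
  have h3 := integral_sub_right_eq_self (μ := volume)
    (fun y : ℝ => μ.re / (μ.re ^ 2 + y ^ 2)) μ.im
  rw [h3]
  have h4 : ∀ y : ℝ, μ.re / (μ.re ^ 2 + y ^ 2) = μ.re⁻¹ * (1 + (μ.re⁻¹ * y) ^ 2)⁻¹ := by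
    intro y
    have : 0 < μ.re ^ 2 + y ^ 2 := by positivity
    field_simp
  simp_rw [h4]
  rw [integral_const_mul, h2, h, inv_inv, abs_of_pos hμ, smul_eq_mul]
  field_simp

/-- The Poisson kernel as a sum of two Cauchy kernels. -/
theorem inv_sub_add_inv_add {μ : ℂ} (hμ : 0 < μ.re) (y : ℝ) :
    (μ - y * Complex.I)⁻¹ + (y * Complex.I + (starRingEnd ℂ) μ)⁻¹ =
      ((2 * (μ.re / (μ.re ^ 2 + (y - μ.im) ^ 2)) : ℝ) : ℂ) := by
  have h1 : μ - y * Complex.I ≠ 0 := fun h => by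
    have := congrArg Complex.re h
    simp at this
    linarith
  have h2 : y * Complex.I + (starRingEnd ℂ) μ ≠ 0 := fun h => by
    have := congrArg Complex.re h
    simp at this
    linarith
  have h3 : (μ - y * Complex.I) * (y * Complex.I + (starRingEnd ℂ) μ) =
      ((μ.re ^ 2 + (y - μ.im) ^ 2 : ℝ) : ℂ) := by
    apply Complex.ext
    · rw [Complex.ofReal_re]
      simp
      ring
    · rw [Complex.ofReal_im]
      simp
      ring
  have h4 : μ + (starRingEnd ℂ) μ = ((2 * μ.re : ℝ) : ℂ) := by
    apply Complex.ext <;> simp; ring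
  have : (μ - y * Complex.I)⁻¹ + (y * Complex.I + (starRingEnd ℂ) μ)⁻¹ =
      (μ + (starRingEnd ℂ) μ) / ((μ - y * Complex.I) * (y * Complex.I + (starRingEnd ℂ) μ)) := by
    field_simp
    ring
  rw [this, h3, h4, ← mul_div_assoc, ← Complex.ofReal_div]

theorem integral_poissonKernel_complex {μ : ℂ} (hμ : 0 < μ.re) :
    ∫ y : ℝ, ((μ - y * Complex.I)⁻¹ + (y * Complex.I + (starRingEnd ℂ) μ)⁻¹) =
      2 * Real.pi := by
  simp_rw [inv_sub_add_inv_add hμ]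
  rw [integral_complex_ofReal, integral_const_mul, integral_poissonKernel hμ]
  push_cast
  rfl

/-- The Cauchy formula on the right half-plane. -/
theorem integral_mul_inv_sub (hf : IsHardyOne f) {μ : ℂ} (hμ : 0 < μ.re) :
    ∫ y : ℝ, f (y * Complex.I) * (μ - y * Complex.I)⁻¹ = 2 * Real.pi * f μ := by
  set c : ℂ := (starRingEnd ℂ) μ with hc
  have hcre : 0 < c.re := by simpa [hc] using hμ
  -- Subtracting the multiple of the mirrored Cauchy kernel that agrees with `f` at `μ` makes the
  -- quotient by `z - μ` holomorphic. The subtracted part times the Cauchy kernel is `f μ` times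
  -- twice the Poisson kernel, whose integral is known.
  set g : ℂ → ℂ := fun z => f z - f μ * (μ + c) * (z + c)⁻¹ with hg
  have hgH : IsHardyOne g := hf.sub ((inv_add hcre).const_mul _)
  have hμc : μ + c ≠ 0 := fun h => by
    have := congrArg Complex.re h
    simp at this
    linarith
  have hgμ : g μ = 0 := by simp [hg, mul_assoc, hμc]
  have hne : ∀ y : ℝ, (y * Complex.I : ℂ) ≠ μ := fun y h => by
    have := congrArg Complex.re h
    simp at this
    linarith
  have hds : ∀ z, z ≠ μ → dslope g μ z = g z * (z - μ)⁻¹ := fun z hz => by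
    rw [dslope_of_ne _ hz, slope_def_field, hgμ, sub_zero, div_eq_mul_inv]
  have heq : ∀ y : ℝ, dslope g μ (y * Complex.I) =
      -(g (y * Complex.I) * (μ - y * Complex.I)⁻¹) := fun y => by
    rw [hds _ (hne y), ← mul_neg, ← inv_neg, neg_sub]
  have key : ∫ y : ℝ, g (y * Complex.I) * (μ - y * Complex.I)⁻¹ = 0 := by
    rw [← neg_eq_zero, ← integral_neg]
    simp_rw [← heq]
    obtain ⟨C, hC⟩ := hgH.bound
    -- For ‖z‖ ≥ 2‖μ‖ one has ‖z - μ‖ ≥ ‖z‖ / 2, whence the factor 2.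
    refine integral_imaginaryAxis_eq_zero (C := 2 * C) (R := max 1 (2 * ‖μ‖ + 1)) ?_ ?_ ?_
    · intro z hz
      by_cases h : z = μ
      · have hU : {z : ℂ | 0 < z.re} ∈ 𝓝 μ :=
          (isOpen_lt continuous_const Complex.continuous_re).mem_nhds hμ
        have := (Complex.differentiableOn_dslope hU (f := g)).2
          fun w hw => (hgH.differentiableAt w (le_of_lt hw)).differentiableWithinAt
        rw [h]
        exact this.differentiableAt hU
      · exact (differentiableAt_dslope_of_ne h).2 (hgH.differentiableAt z hz)
    · intro z hz hR
      have h1 : 1 ≤ ‖z‖ := (le_max_left _ _).trans hR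
      have h2 : 2 * ‖μ‖ + 1 ≤ ‖z‖ := (le_max_right _ _).trans hR
      have h3 : ‖z‖ ≤ 2 * ‖z - μ‖ := by
        have := norm_sub_norm_le z μ
        linarith
      have h4 : z ≠ μ := fun h => by
        rw [h] at h2
        linarith [norm_nonneg μ]
      rw [hds _ h4, norm_mul, norm_inv]
      have hC0 : 0 ≤ C := by
        have a := (norm_nonneg _).trans (hC 0 le_rfl)
        simpa using a
      have h5 : ‖g z‖ ≤ C / ‖z‖ := (hC z hz).trans (by
        rw [← div_eq_mul_inv]
        gcongr
        linarith)
      have h6 : ‖z - μ‖⁻¹ ≤ 2 / ‖z‖ := by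
        rw [inv_le_comm₀ (by linarith) (by positivity), inv_div]
        linarith
      calc _ ≤ (C / ‖z‖) * (2 / ‖z‖) := by gcongr
        _ = _ := by ring
    · simp_rw [heq]
      exact (hgH.integrable_mul_inv_sub hμ).neg
  have hi1 := hf.integrable_mul_inv_sub hμ
  have hi2 := ((inv_add hcre).const_mul (f μ * (μ + c))).integrable_mul_inv_sub hμ
  have h7 : ∫ y : ℝ, f (y * Complex.I) * (μ - y * Complex.I)⁻¹ =
      ∫ y : ℝ, f μ * (μ + c) * (y * Complex.I + c)⁻¹ * (μ - y * Complex.I)⁻¹ := by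
    rw [← sub_eq_zero, ← integral_sub hi1 hi2, ← key]
    congr 1
    ext y
    simp only [hg]
    ring
  have h8 : ∀ y : ℝ, f μ * (μ + c) * (y * Complex.I + c)⁻¹ * (μ - y * Complex.I)⁻¹ =
      f μ * ((μ - y * Complex.I)⁻¹ + (y * Complex.I + (starRingEnd ℂ) μ)⁻¹) := by
    intro y
    have a : μ - y * Complex.I ≠ 0 := fun h => hne y (sub_eq_zero.1 h).symm
    have b : y * Complex.I + c ≠ 0 := fun h => by
      have := congrArg Complex.re h
      simp at this
      linarith
    rw [← hc]
    field_simp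
    ring
  rw [h7]
  simp_rw [h8]
  rw [integral_const_mul, integral_poissonKernel_complex hμ]
  ring

/-- The Poisson formula on the right half-plane. -/
theorem integral_mul_poissonKernel (hf : IsHardyOne f) {μ : ℂ} (hμ : 0 < μ.re) :
    ∫ y : ℝ, f (y * Complex.I) * ((μ.re / (μ.re ^ 2 + (y - μ.im) ^ 2) : ℝ) : ℂ) =
      Real.pi * f μ := by
  have hcre : 0 < ((starRingEnd ℂ) μ).re := by simpa using hμ
  have h := integral_add (hf.integrable_mul_inv_sub hμ) (hf.integrable_mul_inv_add hcre)
  rw [hf.integral_mul_inv_sub hμ, hf.integral_mul_inv_add hcre, add_zero] at h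
  simp_rw [← mul_add, inv_sub_add_inv_add hμ, Complex.ofReal_mul, mul_left_comm _ ((2 : ℝ) : ℂ)] at h
  rw [integral_const_mul, mul_assoc] at h
  simpa using h

theorem lintegral_poissonKernel {x : ℝ} (hx : 0 < x) (y : ℝ) :
    ∫⁻ τ : ℝ, ENNReal.ofReal (x / (x ^ 2 + (τ - y) ^ 2)) = ENNReal.ofReal Real.pi := by
  have h := integral_poissonKernel (μ := ⟨x, y⟩) hx
  simp only at h
  rw [← ofReal_integral_eq_lintegral_ofReal _ (ae_of_all _ fun τ => by positivity), h]
  -- Integrability comes for free: the Bochner integral of a non-integrable function is 0, not π.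
  by_contra hni
  rw [integral_undef hni] at h
  exact Real.pi_ne_zero h.symm

/-- The `L²` norm over a vertical line to the right is at most that over the imaginary axis. -/
theorem lintegral_vertical_le (hf : IsHardyOne f) {x : ℝ} (hx : 0 < x) :
    ∫⁻ y : ℝ, ‖f (x + y * Complex.I)‖ₑ ^ 2 ≤ ∫⁻ y : ℝ, ‖f (y * Complex.I)‖ₑ ^ 2 := by
  set p : ℝ → ℝ → ℝ≥0∞ := fun y τ => ENNReal.ofReal (x / (x ^ 2 + (τ - y) ^ 2)) with hp
  have hpm : Measurable (Function.uncurry p) := by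
    simp only [hp, Function.uncurry_def]
    fun_prop
  have hfm : Measurable (fun τ : ℝ => ‖f (τ * Complex.I)‖ₑ) := hf.continuous_axis_zero.measurable.enorm
  have hpi : ENNReal.ofReal Real.pi ≠ 0 := by simpa using Real.pi_pos
  have hpoint : ∀ y : ℝ, ENNReal.ofReal Real.pi * ‖f (x + y * Complex.I)‖ₑ ^ 2 ≤
      ∫⁻ τ : ℝ, ‖f (τ * Complex.I)‖ₑ ^ 2 * p y τ := by
    intro y
    have hpy : Measurable (p y) := hpm.of_uncurry_left
    have h1 := hf.integral_mul_poissonKernel (μ := x + y * Complex.I) (by simpa using hx)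
    simp only [Complex.add_re, Complex.ofReal_re, Complex.mul_re, Complex.I_re, mul_zero,
      Complex.ofReal_im, Complex.I_im, mul_one, sub_self, add_zero, Complex.add_im, Complex.mul_im,
      zero_add] at h1
    have h2 : ENNReal.ofReal Real.pi * ‖f (x + y * Complex.I)‖ₑ ≤
        ∫⁻ τ : ℝ, ‖f (τ * Complex.I)‖ₑ * p y τ := by
      have h3 := enorm_integral_le_lintegral_enorm (μ := volume) (fun τ : ℝ => f (τ * Complex.I) *
        ((x / (x ^ 2 + (τ - y) ^ 2) : ℝ) : ℂ))
      rw [h1, enorm_mul] at h3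
      convert h3 using 2
      · rw [← ofReal_norm, Complex.norm_real, Real.norm_of_nonneg Real.pi_pos.le]
      · ext τ
        rw [enorm_mul]
        congr 1
        rw [← ofReal_norm, Complex.norm_real, Real.norm_of_nonneg (by positivity)]
    -- Cauchy–Schwarz with the kernel split as √p · √p: this is Jensen's inequality for the Poisson
    -- kernel, whose mass is π.
    have h4 := ENNReal.lintegral_mul_le_Lp_mul_Lq volume Real.HolderConjugate.two_two
      (f := fun τ : ℝ => ‖f (τ * Complex.I)‖ₑ * p y τ ^ (1 / 2 : ℝ)) (g := fun τ : ℝ => p y τ ^ (1 / 2 : ℝ))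
      (by fun_prop) (by fun_prop)
    have hhalf : ∀ a : ℝ≥0∞, (a ^ (1 / 2 : ℝ)) ^ (2 : ℝ) = a := fun a => by
      rw [← ENNReal.rpow_mul]; norm_num
    have h5 : ∀ τ, p y τ ^ (1 / 2 : ℝ) * p y τ ^ (1 / 2 : ℝ) = p y τ := fun τ => by
      rw [← pow_two, ← ENNReal.rpow_natCast]; exact hhalf _
    simp only [Pi.mul_apply, mul_assoc, h5, hhalf, ENNReal.mul_rpow_of_nonneg _ _ zero_le_two] at h4
    have h6 : ∫⁻ τ, p y τ = ENNReal.ofReal Real.pi := lintegral_poissonKernel hx y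
    rw [h6] at h4
    have h7 := ENNReal.rpow_le_rpow (h2.trans h4) zero_le_two
    rw [ENNReal.mul_rpow_of_nonneg _ _ zero_le_two, ENNReal.mul_rpow_of_nonneg _ _ zero_le_two,
      hhalf, hhalf, mul_comm (lintegral _ _)] at h7
    simp only [ENNReal.rpow_two] at h7
    rw [pow_two (ENNReal.ofReal _), mul_assoc] at h7
    exact (ENNReal.mul_le_mul_iff_right hpi ENNReal.ofReal_ne_top).1 h7
  have h8 : ENNReal.ofReal Real.pi * ∫⁻ y : ℝ, ‖f (x + y * Complex.I)‖ₑ ^ 2 ≤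
      ENNReal.ofReal Real.pi * ∫⁻ y : ℝ, ‖f (y * Complex.I)‖ₑ ^ 2 := by
    rw [← lintegral_const_mul' _ _ ENNReal.ofReal_ne_top]
    refine (lintegral_mono hpoint).trans ?_
    rw [lintegral_lintegral_swap]
    · rw [← lintegral_const_mul' _ _ ENNReal.ofReal_ne_top]
      refine lintegral_mono fun τ => ?_
      rw [lintegral_const_mul _ hpm.of_uncurry_right, mul_comm]
      -- After Tonelli the kernel is integrated in its other variable; it is symmetric, so the mass
      -- is again π.
      have h9 : ∫⁻ y, p y τ = ENNReal.ofReal Real.pi := by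
        rw [← lintegral_poissonKernel hx τ]
        refine lintegral_congr fun y => ?_
        simp only [hp]
        rw [← neg_sub, neg_sq]
      rw [h9]
    · refine Measurable.aemeasurable ?_
      exact ((hfm.comp measurable_snd).pow_const 2).mul hpm
  exact (ENNReal.mul_le_mul_iff_right hpi ENNReal.ofReal_ne_top).1 h8

end IsHardyOne

/-! ### Splitting off the last variable, and tensorization -/

section SnocIntegral

variable {k : ℕ}

theorem piFinSuccAbove_last_symm_apply (p : ℝ × (Fin k → ℝ)) :
    (MeasurableEquiv.piFinSuccAbove (fun _ : Fin (k + 1) => ℝ) (Fin.last k)).symm p =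
      Fin.snoc (α := fun _ => ℝ) p.2 p.1 := by
  change (Fin.last k).insertNth (α := fun _ => ℝ) p.1 p.2 = _
  rw [Fin.insertNth_last']

theorem volume_preserving_snoc :
    MeasurePreserving (fun p : ℝ × (Fin k → ℝ) => Fin.snoc (α := fun _ => ℝ) p.2 p.1) := by
  have h := (volume_preserving_piFinSuccAbove (fun _ : Fin (k + 1) => ℝ) (Fin.last k)).symm
  convert h using 1
  ext1 p
  exact (piFinSuccAbove_last_symm_apply p).symm

theorem measurableEmbedding_snoc :
    MeasurableEmbedding (fun p : ℝ × (Fin k → ℝ) => Fin.snoc (α := fun _ => ℝ) p.2 p.1) := by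
  have h := (MeasurableEquiv.piFinSuccAbove (fun _ : Fin (k + 1) => ℝ)
    (Fin.last k)).symm.measurableEmbedding
  convert h using 1
  ext1 p
  exact (piFinSuccAbove_last_symm_apply p).symm

theorem lintegral_snoc {f : (Fin (k + 1) → ℝ) → ℝ≥0∞} (hf : Measurable f) :
    ∫⁻ y, f y = ∫⁻ y : Fin k → ℝ, ∫⁻ z : ℝ, f (Fin.snoc (α := fun _ => ℝ) y z) := by
  rw [← volume_preserving_snoc.lintegral_comp hf]
  exact lintegral_prod_symm _ (hf.comp volume_preserving_snoc.measurable).aemeasurable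

theorem lintegral_snoc' {f : (Fin (k + 1) → ℝ) → ℝ≥0∞} (hf : Measurable f) :
    ∫⁻ y, f y = ∫⁻ z : ℝ, ∫⁻ y : Fin k → ℝ, f (Fin.snoc (α := fun _ => ℝ) y z) := by
  rw [← volume_preserving_snoc.lintegral_comp hf]
  exact lintegral_prod _ (hf.comp volume_preserving_snoc.measurable).aemeasurable

theorem integral_snoc {f : (Fin (k + 1) → ℝ) → ℂ} (hf : Integrable f) :
    ∫ y, f y = ∫ y : Fin k → ℝ, ∫ z : ℝ, f (Fin.snoc (α := fun _ => ℝ) y z) := by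
  rw [← volume_preserving_snoc.integral_comp measurableEmbedding_snoc]
  exact integral_prod_symm _ ((volume_preserving_snoc.integrable_comp_emb measurableEmbedding_snoc).2 hf)

end SnocIntegral

theorem snoc_map {α β : Type*} {k : ℕ} (a : Fin (k + 1) → α → β) (y : Fin k → α) (z : α) :
    (fun j => a j (Fin.snoc (α := fun _ => α) y z j)) =
      Fin.snoc (α := fun _ => β) (fun j => a j.castSucc (y j)) (a (Fin.last k) z) := by
  funext j
  refine Fin.lastCases ?_ (fun i => ?_) j <;> simp

/-- One-dimensional `L²` inequalities between curves, valid in the last variable, tensorize. -/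
theorem lintegral_enorm_sq_le_pow {P : (k : ℕ) → ((Fin k → ℂ) → ℂ) → Prop} {𝒜 : Set (ℝ → ℂ)}
    {b : ℝ → ℂ} (hb : b ∈ 𝒜) {Q : ℝ≥0∞} (hQ : Q ≠ ⊤)
    (hres : ∀ k F, P (k + 1) F → ∀ y, P k fun s => F (Fin.snoc (α := fun _ => ℂ) s (b y)))
    (hsec : ∀ k F, P (k + 1) F → ∀ a ∈ 𝒜, ∀ a' : Fin k → ℝ → ℂ, (∀ j, a' j ∈ 𝒜) → ∀ y : Fin k → ℝ,
      ∫⁻ z, ‖F (Fin.snoc (α := fun _ => ℂ) (fun j => a' j (y j)) (a z))‖ₑ ^ 2 ≤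
        Q * ∫⁻ z, ‖F (Fin.snoc (α := fun _ => ℂ) (fun j => a' j (y j)) (b z))‖ₑ ^ 2)
    (hmeas : ∀ k F, P k F → ∀ a : Fin k → ℝ → ℂ, (∀ j, a j ∈ 𝒜) →
      Measurable fun y : Fin k → ℝ => F fun j => a j (y j)) :
    ∀ k F, P k F → ∀ a : Fin k → ℝ → ℂ, (∀ j, a j ∈ 𝒜) →
      ∫⁻ y : Fin k → ℝ, ‖F fun j => a j (y j)‖ₑ ^ 2 ≤
        Q ^ k * ∫⁻ y : Fin k → ℝ, ‖F fun j => b (y j)‖ₑ ^ 2 := by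
  intro k
  induction k with
  | zero =>
    intro F _ a _
    rw [pow_zero, one_mul]
    refine le_of_eq (lintegral_congr fun y => ?_)
    congr 3
    exact Subsingleton.elim _ _
  | succ k ih =>
    intro F hF a ha
    -- The last curve is moved to `b` first, with the others frozen; then the order of integration
    -- is exchanged and the induction hypothesis is applied to the slices at `b z`. This is why
    -- `hres` is needed only along `b`.
    set a' : Fin (k + 1) → ℝ → ℂ := Fin.snoc (α := fun _ => ℝ → ℂ) (fun j => a j.castSucc) b with ha'
    have ha'mem : ∀ j, a' j ∈ 𝒜 := by
      intro j
      refine Fin.lastCases ?_ (fun i => ?_) j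
      · simpa [ha'] using hb
      · simpa [ha'] using ha _
    have hm1 := ((hmeas _ F hF a ha).enorm).pow_const 2
    have hm2 := ((hmeas _ F hF a' ha'mem).enorm).pow_const 2
    have hm3 := ((hmeas _ F hF (fun _ => b) fun _ => hb).enorm).pow_const 2
    calc ∫⁻ y : Fin (k + 1) → ℝ, ‖F fun j => a j (y j)‖ₑ ^ 2
        = ∫⁻ y : Fin k → ℝ, ∫⁻ z : ℝ, ‖F (Fin.snoc (α := fun _ => ℂ)
            (fun j => a j.castSucc (y j)) (a (Fin.last k) z))‖ₑ ^ 2 := by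
          rw [lintegral_snoc hm1]
          simp_rw [snoc_map]
      _ ≤ ∫⁻ y : Fin k → ℝ, Q * ∫⁻ z : ℝ, ‖F (Fin.snoc (α := fun _ => ℂ)
            (fun j => a j.castSucc (y j)) (b z))‖ₑ ^ 2 :=
          lintegral_mono fun y => hsec k F hF _ (ha _) _ (fun j => ha _) y
      _ = Q * ∫⁻ y : Fin (k + 1) → ℝ, ‖F fun j => a' j (y j)‖ₑ ^ 2 := by
          rw [lintegral_const_mul' _ _ hQ, lintegral_snoc hm2]
          simp_rw [snoc_map, ha', Fin.snoc_castSucc, Fin.snoc_last]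
      _ = Q * ∫⁻ z : ℝ, ∫⁻ y : Fin k → ℝ, ‖F (Fin.snoc (α := fun _ => ℂ)
            (fun j => a j.castSucc (y j)) (b z))‖ₑ ^ 2 := by
          rw [lintegral_snoc' hm2]
          simp_rw [snoc_map, ha', Fin.snoc_castSucc, Fin.snoc_last]
      _ ≤ Q * ∫⁻ z : ℝ, Q ^ k * ∫⁻ y : Fin k → ℝ, ‖F (Fin.snoc (α := fun _ => ℂ)
            (fun j => b (y j)) (b z))‖ₑ ^ 2 := by
          gcongr with z
          exact ih _ (hres k F hF z) (fun j => a j.castSucc) fun j => ha _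
      _ = _ := by
          rw [lintegral_const_mul' _ _ (ENNReal.pow_ne_top hQ), lintegral_snoc' hm3, pow_succ',
            mul_assoc]
          simp_rw [snoc_map]

/-! ### Hardy functions of several variables -/

/-- Functions of several variables that are holomorphic on the closed right poly-half-plane and
decay like `∏ 1 / |sⱼ|` there. -/
structure IsHardy {k : ℕ} (F : (Fin k → ℂ) → ℂ) : Prop where
  differentiableAt : ∀ s : Fin k → ℂ, (∀ j, 0 ≤ (s j).re) → DifferentiableAt ℂ F s
  bound : ∃ C, ∀ s : Fin k → ℂ, (∀ j, 0 ≤ (s j).re) → ‖F s‖ ≤ C * ∏ j, (1 + ‖s j‖)⁻¹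

namespace IsHardy

section Basic

variable {k : ℕ} {F G : (Fin k → ℂ) → ℂ}

theorem sub (hF : IsHardy F) (hG : IsHardy G) : IsHardy (F - G) := by
  obtain ⟨C, hC⟩ := hF.bound
  obtain ⟨D, hD⟩ := hG.bound
  refine ⟨fun s hs => (hF.differentiableAt s hs).sub (hG.differentiableAt s hs), C + D,
    fun s hs => (norm_sub_le _ _).trans ?_⟩
  rw [add_mul]
  exact add_le_add (hC s hs) (hD s hs)

theorem continuous_comp (hF : IsHardy F) {a : Fin k → ℝ → ℂ} (ha : ∀ j, Continuous (a j))
    (hre : ∀ j y, 0 ≤ (a j y).re) : Continuous (fun y : Fin k → ℝ => F fun j => a j (y j)) := by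
  rw [continuous_iff_continuousAt]
  intro y
  have h := (hF.differentiableAt (fun j => a j (y j)) fun j => hre j _).continuousAt
  refine ContinuousAt.comp (f := fun y : Fin k → ℝ => fun j => a j (y j)) h ?_
  exact Continuous.continuousAt (continuous_pi fun j => (ha j).comp (continuous_apply j))

theorem continuous_axis (hF : IsHardy F) :
    Continuous (fun y : Fin k → ℝ => F fun j => y j * Complex.I) :=
  hF.continuous_comp (a := fun _ y => y * Complex.I) (fun _ => by fun_prop) (by simp)

theorem integrable_prod_inv_sq :
    Integrable (fun y : Fin k → ℝ => ∏ j, ((1 + |y j|)⁻¹ * (1 + |y j|)⁻¹)) :=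
  Integrable.fintype_prod (f := fun _ y => (1 + |y|)⁻¹ * (1 + |y|)⁻¹) fun _ => integrable_inv_sq

theorem integrable_mul (hF : IsHardy F) {h : (Fin k → ℝ) → ℂ} (hh : Continuous h) {D : ℝ}
    (hD : ∀ y, ‖h y‖ ≤ D * ∏ j, (1 + |y j|)⁻¹) :
    Integrable (fun y : Fin k → ℝ => (F fun j => y j * Complex.I) * h y) := by
  obtain ⟨C, hC⟩ := hF.bound
  refine (integrable_prod_inv_sq.const_mul (C * D)).mono'
    (hF.continuous_axis.mul hh).aestronglyMeasurable (ae_of_all _ fun y => ?_)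
  have h1 := hC (fun j => y j * Complex.I) (by simp)
  simp only [norm_mul, Complex.norm_I, mul_one, Complex.norm_real, Real.norm_eq_abs] at h1
  rw [norm_mul, Finset.prod_mul_distrib]
  calc _ ≤ (C * ∏ j, (1 + |y j|)⁻¹) * (D * ∏ j, (1 + |y j|)⁻¹) :=
        mul_le_mul h1 (hD y) (norm_nonneg _) ((norm_nonneg _).trans h1)
    _ = _ := by ring

theorem integrable_mul_prod_inv_sub (hF : IsHardy F) {μ : Fin k → ℂ} (hμ : ∀ j, 0 < (μ j).re) :
    Integrable (fun y : Fin k → ℝ =>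
      (F fun j => y j * Complex.I) * ∏ j, (μ j - y j * Complex.I)⁻¹) := by
  refine hF.integrable_mul (D := ∏ j, ((1 + ‖μ j‖) / (μ j).re + 1)) ?_ fun y => ?_
  · exact continuous_finsetProd _ fun j _ =>
      (IsHardyOne.continuous_inv_sub (hμ j)).comp (continuous_apply j)
  · rw [norm_prod, ← Finset.prod_mul_distrib]
    exact Finset.prod_le_prod (fun _ _ => norm_nonneg _)
      fun j _ => IsHardyOne.norm_inv_sub_le (hμ j) (y j)

theorem integrable_norm_sq (hF : IsHardy F) :
    Integrable (fun y : Fin k → ℝ => ‖F fun j => y j * Complex.I‖ ^ 2) := by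
  obtain ⟨C, hC⟩ := hF.bound
  have h := (hF.integrable_mul (h := fun y => (starRingEnd ℂ) (F fun j => y j * Complex.I))
    (D := C) (Complex.continuous_conj.comp hF.continuous_axis) fun y => ?_).norm
  · refine h.congr (ae_of_all _ fun y => ?_)
    simp [pow_two]
  · have := hC (fun j => y j * Complex.I) (by simp)
    simpa using this

end Basic

variable {k : ℕ} {F : (Fin (k + 1) → ℂ) → ℂ}

theorem snoc_right (hF : IsHardy F) {z : ℂ} (hz : 0 ≤ z.re) :
    IsHardy (fun s : Fin k → ℂ => F (Fin.snoc (α := fun _ => ℂ) s z)) := by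
  have hre : ∀ s : Fin k → ℂ, (∀ j, 0 ≤ (s j).re) → ∀ j,
      0 ≤ (Fin.snoc (α := fun _ => ℂ) s z j : ℂ).re := by
    intro s hs j
    refine Fin.lastCases ?_ (fun i => ?_) j
    · simpa using hz
    · simpa using hs i
  obtain ⟨C, hC⟩ := hF.bound
  refine ⟨fun s hs => ?_, C * (1 + ‖z‖)⁻¹, fun s hs => ?_⟩
  · refine DifferentiableAt.comp (f := fun s : Fin k → ℂ => Fin.snoc (α := fun _ => ℂ) s z) s
      (hF.differentiableAt _ (hre s hs)) (differentiableAt_pi.2 fun j => ?_)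
    refine Fin.lastCases ?_ (fun i => ?_) j
    · simp
    · simpa using differentiableAt_apply i s
  · refine (hC _ (hre s hs)).trans (le_of_eq ?_)
    rw [Fin.prod_univ_castSucc]
    simp only [Fin.snoc_castSucc, Fin.snoc_last]
    ring

theorem snoc_left (hF : IsHardy F) {s : Fin k → ℂ} (hs : ∀ j, 0 ≤ (s j).re) :
    IsHardyOne (fun z : ℂ => F (Fin.snoc (α := fun _ => ℂ) s z)) := by
  have hre : ∀ z : ℂ, 0 ≤ z.re → ∀ j,
      0 ≤ (Fin.snoc (α := fun _ => ℂ) s z j : ℂ).re := by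
    intro z hz j
    refine Fin.lastCases ?_ (fun i => ?_) j
    · simpa using hz
    · simpa using hs i
  obtain ⟨C, hC⟩ := hF.bound
  refine ⟨fun z hz => ?_, C * ∏ j, (1 + ‖s j‖)⁻¹, fun z hz => ?_⟩
  · refine DifferentiableAt.comp (f := fun z : ℂ => Fin.snoc (α := fun _ => ℂ) s z) z
      (hF.differentiableAt _ (hre z hz)) (differentiableAt_pi.2 fun j => ?_)
    refine Fin.lastCases ?_ (fun i => ?_) j
    · simp
    · simp
  · refine (hC _ (hre z hz)).trans (le_of_eq ?_)
    rw [Fin.prod_univ_castSucc]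
    simp only [Fin.snoc_castSucc, Fin.snoc_last]
    ring

end IsHardy

/-- The Cauchy formula on the right poly-half-plane. -/
theorem IsHardy.integral_mul_prod_inv_sub {k : ℕ} {F : (Fin k → ℂ) → ℂ} (hF : IsHardy F)
    {μ : Fin k → ℂ} (hμ : ∀ j, 0 < (μ j).re) :
    ∫ y : Fin k → ℝ, (F fun j => y j * Complex.I) * ∏ j, (μ j - y j * Complex.I)⁻¹ =
      (2 * Real.pi) ^ k * F μ := by
  induction k with
  | zero =>
    simp only [Finset.univ_eq_empty, Finset.prod_empty, mul_one, pow_zero, one_mul]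
    have h0 : ∀ s, F s = F μ := fun s => congrArg F (Subsingleton.elim _ _)
    rw [integral_unique, h0]
    simp [volume_pi, measureReal_def]
  | succ k ih =>
    rw [integral_snoc (hF.integrable_mul_prod_inv_sub hμ)]
    have h1 : ∀ y : Fin k → ℝ, ∫ z : ℝ, (F fun j => (Fin.snoc (α := fun _ => ℝ) y z j : ℝ) * Complex.I) *
        ∏ j, (μ j - (Fin.snoc (α := fun _ => ℝ) y z j : ℝ) * Complex.I)⁻¹ =
        2 * Real.pi * (F (Fin.snoc (α := fun _ => ℂ) (fun j => y j * Complex.I) (μ (Fin.last k))) *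
        ∏ j : Fin k, (μ j.castSucc - y j * Complex.I)⁻¹) := by
      intro y
      have h2 := (hF.snoc_left (s := fun j => y j * Complex.I) (by simp)).integral_mul_inv_sub
        (hμ (Fin.last k))
      rw [← mul_assoc, ← h2, ← integral_mul_const]
      congr 1
      ext z
      rw [Fin.prod_univ_castSucc]
      simp only [Fin.snoc_castSucc, Fin.snoc_last]
      rw [snoc_map (fun _ (y : ℝ) => (y * Complex.I : ℂ))]
      ring
    simp_rw [h1]
    rw [integral_const_mul, ih (hF.snoc_right (hμ _).le) fun j => hμ j.castSucc]
    have h3 : Fin.snoc (α := fun _ => ℂ) (fun j : Fin k => μ j.castSucc) (μ (Fin.last k)) = μ :=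
      Fin.snoc_init_self μ
    rw [h3]
    ring

/-- Tensorization with factor 1, the admissible curves being the vertical lines in the closed
half-plane and the reference curve the imaginary axis. -/
theorem IsHardy.lintegral_vertical_le {k : ℕ} {F : (Fin k → ℂ) → ℂ} (hF : IsHardy F)
    {x : Fin k → ℝ} (hx : ∀ j, 0 ≤ x j) :
    ∫⁻ y : Fin k → ℝ, ‖F fun j => x j + y j * Complex.I‖ₑ ^ 2 ≤
      ∫⁻ y : Fin k → ℝ, ‖F fun j => y j * Complex.I‖ₑ ^ 2 := by
  have := lintegral_enorm_sq_le_pow (P := fun k F => IsHardy F)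
    (𝒜 := {a | ∃ x : ℝ, 0 ≤ x ∧ a = fun y : ℝ => (x + y * Complex.I : ℂ)})
    (b := fun y => y * Complex.I) ⟨0, le_rfl, by simp⟩ ENNReal.one_ne_top
    (fun k F hF y => hF.snoc_right (by simp)) ?_ ?_ k F hF
    (fun j y => x j + y * Complex.I) fun j => ⟨x j, hx j, rfl⟩
  · simpa using this
  · rintro k F hF _ ⟨x, hx, rfl⟩ a' ha' y
    have hs := hF.snoc_left (s := fun j => a' j (y j)) fun j => by
      obtain ⟨x, hx, h⟩ := ha' j
      simpa [h] using hx
    rw [one_mul]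
    rcases hx.eq_or_lt with rfl | hx
    · simp
    · exact hs.lintegral_vertical_le hx
  · intro k F hF a ha
    refine (hF.continuous_comp (fun j => ?_) fun j y => ?_).measurable
    · obtain ⟨x, hx, h⟩ := ha j
      rw [h]
      fun_prop
    · obtain ⟨x, hx, h⟩ := ha j
      simpa [h] using hx

/-! ### The H₂ norm as an L² norm on the imaginary axes -/

/-- The mean square of `F` on the imaginary axes. -/
noncomputable def axisNormSq {k : ℕ} (F : (Fin k → ℂ) → ℂ) : ℝ :=
  ((2 * Real.pi) ^ k)⁻¹ * ∫ y : Fin k → ℝ, ‖F fun j => y j * Complex.I‖ ^ 2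

theorem axisNormSq_nonneg {k : ℕ} (F : (Fin k → ℂ) → ℂ) : 0 ≤ axisNormSq F :=
  mul_nonneg (by positivity) (integral_nonneg fun _ => by positivity)

theorem IsHardy.lintegral_enorm_sq {k : ℕ} {F : (Fin k → ℂ) → ℂ} (hF : IsHardy F) :
    ∫⁻ y : Fin k → ℝ, ‖F fun j => y j * Complex.I‖ₑ ^ 2 =
      ENNReal.ofReal (∫ y : Fin k → ℝ, ‖F fun j => y j * Complex.I‖ ^ 2) := by
  rw [ofReal_integral_eq_lintegral_ofReal hF.integrable_norm_sq (ae_of_all _ fun _ => by positivity)]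
  refine lintegral_congr fun y => ?_
  rw [ENNReal.ofReal_pow (norm_nonneg _), ofReal_norm]

/-- The axes dominate every vertical translate, and conversely Fatou's lemma along the abscissas 1 /
(n + 1) recovers the axis integral, by continuity up to the boundary. -/
theorem IsHardy.iSup_lintegral_vertical {k : ℕ} {F : (Fin k → ℂ) → ℂ} (hF : IsHardy F) :
    ⨆ x : {x : Fin k → ℝ // ∀ i, 0 < x i}, (ENNReal.ofReal ((2 * Real.pi) ^ k))⁻¹ *
      ∫⁻ y : Fin k → ℝ, ‖F (fun i => (x.1 i : ℂ) + (y i : ℂ) * Complex.I)‖ₑ ^ 2 =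
      ENNReal.ofReal (axisNormSq F) := by
  have hpi : 0 < (2 * Real.pi) ^ k := by positivity
  have h0 : ENNReal.ofReal (axisNormSq F) = (ENNReal.ofReal ((2 * Real.pi) ^ k))⁻¹ *
      ∫⁻ y : Fin k → ℝ, ‖F fun j => y j * Complex.I‖ₑ ^ 2 := by
    rw [axisNormSq, ENNReal.ofReal_mul (by positivity), ENNReal.ofReal_inv_of_pos hpi,
      hF.lintegral_enorm_sq]
  rw [h0, ← ENNReal.mul_iSup]
  congr 1
  refine le_antisymm (iSup_le fun x => hF.lintegral_vertical_le fun j => (x.2 j).le) ?_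
  set u : ℕ → ℝ := fun n => 1 / ((n : ℝ) + 1) with hu
  have hupos : ∀ n, 0 < u n := fun n => Nat.one_div_pos_of_nat
  have hulim : Tendsto u atTop (𝓝 0) := tendsto_one_div_add_atTop_nhds_zero_nat
  have hfatou := lintegral_liminf_le (μ := volume) (u := atTop)
    (f := fun (n : ℕ) (y : Fin k → ℝ) => ‖F fun j => u n + y j * Complex.I‖ₑ ^ 2) fun n =>
      ((hF.continuous_comp (a := fun _ y => u n + y * Complex.I) (fun _ => by fun_prop)
        (by simpa using fun _ => (hupos n).le)).measurable.enorm).pow_const 2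
  have hlim : ∀ y : Fin k → ℝ, liminf (fun n : ℕ => ‖F fun j => u n + y j * Complex.I‖ₑ ^ 2) atTop =
      ‖F fun j => y j * Complex.I‖ₑ ^ 2 := by
    intro y
    refine Tendsto.liminf_eq ?_
    have h1 := (hF.differentiableAt (fun j => y j * Complex.I) (by simp)).continuousAt
    have h2 : Tendsto (fun n : ℕ => fun j => (u n + y j * Complex.I : ℂ)) atTop
        (𝓝 fun j => y j * Complex.I) := by
      refine tendsto_pi_nhds.2 fun j => ?_
      have := ((Complex.continuous_ofReal.tendsto 0).comp hulim).add_const (y j * Complex.I)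
      simpa using this
    exact ((ENNReal.continuous_pow 2).tendsto _).comp ((continuous_enorm.tendsto _).comp (h1.tendsto.comp h2))
  simp_rw [hlim] at hfatou
  refine hfatou.trans ?_
  refine liminf_le_of_frequently_le' (Frequently.of_forall fun n => ?_)
  exact le_iSup (fun x : {x : Fin k → ℝ // ∀ i, 0 < x i} =>
    ∫⁻ y : Fin k → ℝ, ‖F (fun i => (x.1 i : ℂ) + (y i : ℂ) * Complex.I)‖ₑ ^ 2) ⟨fun _ => u n, fun _ => hupos n⟩

theorem h2Norm_eq_of_isHardy {F : TransferFamily} (hF : ∀ k, IsHardy (F k)) :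
    h2Norm F = (∑' k, ENNReal.ofReal (axisNormSq (F k))) ^ (1 / 2 : ℝ) := by
  unfold h2Norm
  congr 1
  exact tsum_congr fun k => (hF k).iSup_lintegral_vertical

theorem h2Norm_lt_top_iff {F : TransferFamily} (hF : ∀ k, IsHardy (F k)) :
    h2Norm F < ⊤ ↔ Summable fun k => axisNormSq (F k) := by
  rw [h2Norm_eq_of_isHardy hF, ENNReal.rpow_lt_top_iff_of_pos (by norm_num)]
  constructor
  · intro h
    have := ENNReal.summable_toReal h.ne
    simpa [ENNReal.toReal_ofReal (axisNormSq_nonneg _)] using this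
  · intro h
    rw [← ENNReal.ofReal_tsum_of_nonneg (fun _ => axisNormSq_nonneg _) h]
    exact ENNReal.ofReal_lt_top

theorem h2Norm_le_iff {F G : TransferFamily} (hF : ∀ k, IsHardy (F k)) (hG : ∀ k, IsHardy (G k))
    (hsF : Summable fun k => axisNormSq (F k)) (hsG : Summable fun k => axisNormSq (G k)) :
    h2Norm F ≤ h2Norm G ↔ ∑' k, axisNormSq (F k) ≤ ∑' k, axisNormSq (G k) := by
  rw [h2Norm_eq_of_isHardy hF, h2Norm_eq_of_isHardy hG, ENNReal.rpow_le_rpow_iff (by norm_num),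
    ← ENNReal.ofReal_tsum_of_nonneg (fun _ => axisNormSq_nonneg _) hsF,
    ← ENNReal.ofReal_tsum_of_nonneg (fun _ => axisNormSq_nonneg _) hsG,
    ENNReal.ofReal_le_ofReal_iff (tsum_nonneg fun _ => axisNormSq_nonneg _)]

/-! ### Transfer functions of stable systems are Hardy functions -/

namespace IsHardy

theorem const_mul {k : ℕ} {F : (Fin k → ℂ) → ℂ} (hF : IsHardy F) (c : ℂ) :
    IsHardy (fun s => c * F s) := by
  obtain ⟨C, hC⟩ := hF.bound
  refine ⟨fun s hs => (hF.differentiableAt s hs).const_mul c, ‖c‖ * C, fun s hs => ?_⟩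
  rw [norm_mul, mul_assoc]
  gcongr
  exact hC s hs

theorem sum {k : ℕ} {ι : Type*} {F : ι → (Fin k → ℂ) → ℂ} {S : Finset ι}
    (hF : ∀ i ∈ S, IsHardy (F i)) : IsHardy (fun s => ∑ i ∈ S, F i s) := by
  classical
  induction S using Finset.induction_on with
  | empty => exact ⟨fun s _ => by simp, 0, fun s _ => by simp⟩
  | insert i S hi ih =>
    have h1 := hF i (Finset.mem_insert_self _ _)
    have h2 := ih fun j hj => hF j (Finset.mem_insert_of_mem hj)
    have h3 := h1.sub (h2.const_mul (-1))
    convert h3 using 1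
    ext s
    simp [Finset.sum_insert hi]

theorem of_one {f : ℂ → ℂ} (hf : IsHardyOne f) : IsHardy (fun s : Fin 1 → ℂ => f (s 0)) := by
  obtain ⟨C, hC⟩ := hf.bound
  refine ⟨fun s hs => ?_, C, fun s hs => by simpa using hC (s 0) (hs 0)⟩
  exact DifferentiableAt.comp (f := fun s : Fin 1 → ℂ => s 0) s (hf.differentiableAt _ (hs 0))
    (differentiableAt_apply 0 s)

theorem mul_init {k : ℕ} {f : ℂ → ℂ} (hf : IsHardyOne f) {G : (Fin k → ℂ) → ℂ} (hG : IsHardy G) :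
    IsHardy (fun s : Fin (k + 1) → ℂ => f (s (Fin.last k)) * G (Fin.init s)) := by
  obtain ⟨C, hC⟩ := hf.bound
  obtain ⟨D, hD⟩ := hG.bound
  refine ⟨fun s hs => ?_, C * D, fun s hs => ?_⟩
  · refine DifferentiableAt.mul ?_ ?_
    · exact DifferentiableAt.comp (f := fun s : Fin (k + 1) → ℂ => s (Fin.last k)) s
        (hf.differentiableAt _ (hs _)) (differentiableAt_apply _ s)
    · exact DifferentiableAt.comp (f := fun s : Fin (k + 1) → ℂ => (Fin.init s : Fin k → ℂ)) s
        (hG.differentiableAt _ fun j => hs _)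
        (differentiableAt_pi.2 fun j => differentiableAt_apply (Fin.castSucc j) s)
  · have h1 := hC _ (hs (Fin.last k))
    have h2 := hD (Fin.init s) fun j => hs _
    rw [norm_mul, Fin.prod_univ_castSucc]
    refine (mul_le_mul h1 h2 (norm_nonneg _) ((norm_nonneg _).trans h1)).trans (le_of_eq ?_)
    simp only [Fin.init]
    ring

end IsHardy

namespace BilinearSystem

variable {n : ℕ} (ζ : BilinearSystem n)

theorem isRoot_charpoly_iff (z : ℂ) :
    ζ.Ac.charpoly.IsRoot z ↔ (z • (1 : Matrix (Fin n) (Fin n) ℂ) - ζ.Ac).det = 0 := by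
  rw [Polynomial.IsRoot, Matrix.eval_charpoly, Matrix.smul_one_eq_diagonal]
  rfl

variable {ζ} in
theorem IsStable.isUnit (hζ : ζ.IsStable) {z : ℂ} (hz : 0 ≤ z.re) :
    IsUnit (z • (1 : Matrix (Fin n) (Fin n) ℂ) - ζ.Ac) := by
  rw [Matrix.isUnit_iff_isUnit_det, isUnit_iff_ne_zero, Ne, ← isRoot_charpoly_iff]
  exact fun h => absurd (hζ z h) (not_lt.2 hz)

theorem resolv_eq_resolvent (z : ℂ) : ζ.resolv z = resolvent ζ.Ac z := by
  rw [resolv, resolvent, Matrix.nonsing_inv_eq_ringInverse, Algebra.algebraMap_eq_smul_one]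

-- The resolvent is holomorphic off the spectrum and O(1 / |z|) at infinity; the remaining part of
-- the closed half-plane is compact. Outside the disc ‖z‖ > 1, so 1 + ‖z‖ ≤ 2‖z‖ there.
open scoped Matrix.Norms.Operator in
variable {ζ} in
theorem IsStable.isHardyOne_resolv (hζ : ζ.IsStable) (i j : Fin n) :
    IsHardyOne (fun z => ζ.resolv z i j) := by
  set e : Matrix (Fin n) (Fin n) ℂ →L[ℂ] ℂ :=
    LinearMap.toContinuousLinearMap (Matrix.entryLinearMap ℂ ℂ i j) with he
  have he' : (fun z => ζ.resolv z i j) = fun z => e (resolvent ζ.Ac z) := by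
    ext z
    rw [resolv_eq_resolvent]
    rfl
  rw [he']
  have hd : ∀ z : ℂ, 0 ≤ z.re → DifferentiableAt ℂ (fun z => e (resolvent ζ.Ac z)) z := by
    intro z hz
    have hmem : z ∈ resolventSet ℂ ζ.Ac := by
      rw [spectrum.mem_resolventSet_iff, Algebra.algebraMap_eq_smul_one]
      exact hζ.isUnit hz
    exact e.differentiableAt.comp z (spectrum.hasDerivAt_resolvent_const_left hmem).differentiableAt
  refine ⟨hd, ?_⟩
  obtain ⟨c, hc⟩ := (e.isBigO_comp (resolvent ζ.Ac) (Bornology.cobounded ℂ)).trans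
    (spectrum.resolvent_isBigO_inv ζ.Ac) |>.bound
  obtain ⟨R, hR⟩ := (Metric.hasBasis_cobounded_compl_closedBall (0 : ℂ)).eventually_iff.1 hc
  have hcomp : IsCompact (Metric.closedBall (0 : ℂ) (max R 1) ∩ {z : ℂ | 0 ≤ z.re}) :=
    (isCompact_closedBall _ _).inter_right (isClosed_le continuous_const Complex.continuous_re)
  obtain ⟨B, hB⟩ := hcomp.exists_bound_of_continuousOn (f := fun z => e (resolvent ζ.Ac z))
    fun z hz => (hd z hz.2).continuousAt.continuousWithinAt
  refine ⟨max (2 * |c|) (|B| * (1 + max R 1)), fun z hz => ?_⟩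
  rw [← div_eq_mul_inv, le_div_iff₀ (by positivity)]
  by_cases h : ‖z‖ ≤ max R 1
  · refine le_trans ?_ (le_max_right _ _)
    have := (hB z ⟨by simpa using h, hz⟩).trans (le_abs_self B)
    gcongr
  · refine le_trans ?_ (le_max_left _ _)
    rw [not_le, max_lt_iff] at h
    have h1 := hR.2 (x := z) (by simpa using h.1)
    have h2 : 0 < ‖z‖ := by linarith
    rw [norm_inv, ← div_eq_mul_inv, le_div_iff₀ h2] at h1
    have := le_abs_self c
    have h3 := mul_le_mul_of_nonneg_left h.2.le (norm_nonneg (e (resolvent ζ.Ac z)))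
    change ‖e (resolvent ζ.Ac z)‖ * (1 + ‖z‖) ≤ 2 * |c|
    calc ‖e (resolvent ζ.Ac z)‖ * (1 + ‖z‖)
        = ‖e (resolvent ζ.Ac z)‖ * 1 + ‖e (resolvent ζ.Ac z)‖ * ‖z‖ := mul_add _ _ _
      _ ≤ c + c := add_le_add (h3.trans h1) h1
      _ ≤ 2 * |c| := by linarith

variable {ζ} in
theorem IsStable.isHardy_inputToState (hζ : ζ.IsStable) (k : ℕ) (i : Fin n) :
    IsHardy (fun s => ζ.inputToState k s i) := by
  induction k generalizing i with
  | zero =>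
    have : (fun s => ζ.inputToState 0 s i) = fun s : Fin 1 → ℂ =>
        ∑ j, (ζ.b j : ℂ) * ζ.resolv (s 0) i j := by
      ext s
      simp only [inputToState, Matrix.mulVec, dotProduct, mul_comm]
    rw [this]
    exact IsHardy.sum fun j _ => (IsHardy.of_one (hζ.isHardyOne_resolv i j)).const_mul _
  | succ k ih =>
    have : (fun s => ζ.inputToState (k + 1) s i) = fun s : Fin (k + 2) → ℂ =>
        ∑ j, ζ.resolv (s (Fin.last (k + 1))) i j *
          (∑ m, ζ.Nc j m * ζ.inputToState k (Fin.init s) m) := by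
      ext s
      simp only [inputToState, Matrix.mulVec, dotProduct]
    rw [this]
    exact IsHardy.sum fun j _ => IsHardy.mul_init (hζ.isHardyOne_resolv i j)
      (G := fun s => ∑ m, ζ.Nc j m * ζ.inputToState k s m)
      (IsHardy.sum fun m _ => (ih m).const_mul _)

variable {ζ} in
theorem IsStable.isHardy_transfer (hζ : ζ.IsStable) (k : ℕ) : IsHardy (ζ.transfer k) :=
  IsHardy.sum (S := Finset.univ) (F := fun i s => (ζ.c i : ℂ) * ζ.inputToState k s i)
    fun i _ => (hζ.isHardy_inputToState k i).const_mul _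

section Reality

theorem resolv_conj (z : ℂ) :
    ζ.resolv ((starRingEnd ℂ) z) = (ζ.resolv z).map (starRingEnd ℂ) := by
  have h1 : ∀ M : Matrix (Fin n) (Fin n) ℂ, M.map (starRingEnd ℂ) = Mᴴᵀ := fun M => rfl
  rw [h1, resolv, resolv, Matrix.conjTranspose_nonsing_inv, Matrix.transpose_nonsing_inv, ← h1]
  congr 1
  ext i j
  by_cases h : i = j <;> simp [Ac, h]

theorem mulVec_conj (M : Matrix (Fin n) (Fin n) ℂ) (v : Fin n → ℂ) (i : Fin n) :
    (M.map (starRingEnd ℂ) *ᵥ fun j => (starRingEnd ℂ) (v j)) i = (starRingEnd ℂ) ((M *ᵥ v) i) := by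
  simp [Matrix.mulVec, dotProduct]

theorem inputToState_conj (k : ℕ) (s : Fin (k + 1) → ℂ) :
    ζ.inputToState k (fun j => (starRingEnd ℂ) (s j)) =
      fun i => (starRingEnd ℂ) (ζ.inputToState k s i) := by
  induction k with
  | zero =>
    ext i
    simp only [inputToState]
    rw [resolv_conj, ← mulVec_conj]
    simp
  | succ k ih =>
    ext i
    have hN : ζ.Nc = ζ.Nc.map (starRingEnd ℂ) := by
      ext i j
      simp [Nc]
    have h1 : ζ.inputToState (k + 1) (fun j => (starRingEnd ℂ) (s j)) =
        ζ.resolv ((starRingEnd ℂ) (s (Fin.last (k + 1)))) *ᵥ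
          (ζ.Nc *ᵥ ζ.inputToState k (fun j => (starRingEnd ℂ) (Fin.init s j))) := rfl
    rw [h1, ih, resolv_conj]
    nth_rewrite 1 [hN]
    have h2 : (ζ.Nc.map (starRingEnd ℂ) *ᵥ
        fun i => (starRingEnd ℂ) (ζ.inputToState k (Fin.init s) i)) =
        fun i => (starRingEnd ℂ) ((ζ.Nc *ᵥ ζ.inputToState k (Fin.init s)) i) :=
      funext fun i => mulVec_conj _ _ i
    rw [h2, mulVec_conj]
    rfl

/-- Reality serves twice: it removes the conjugate from the L² inner product on the axes, and it
makes the pairings real, so that stationarity of real parts gives complex identities. -/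
theorem transfer_conj (k : ℕ) (s : Fin (k + 1) → ℂ) :
    ζ.transfer k (fun j => (starRingEnd ℂ) (s j)) = (starRingEnd ℂ) (ζ.transfer k s) := by
  simp [transfer, inputToState_conj, dotProduct]

end Reality

/-! ### The two-parameter perturbation -/

/-- The system with shifted matrix `A + t I` and scaled output `(1 + κ) c`. -/
noncomputable def perturb (t κ : ℝ) : BilinearSystem n where
  A := ζ.A + t • (1 : Matrix (Fin n) (Fin n) ℝ)
  N := ζ.N
  b := ζ.b
  c := (1 + κ) • ζ.c

theorem perturb_zero : ζ.perturb 0 0 = ζ := by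
  cases ζ
  simp [perturb]

theorem continuous_perturb : Continuous (fun p : ℝ × ℝ => ζ.perturb p.1 p.2) := by
  refine continuous_induced_rng.2 ?_
  change Continuous fun p : ℝ × ℝ => (ζ.A + p.1 • (1 : Matrix (Fin n) (Fin n) ℝ), ζ.N, ζ.b,
    (1 + p.2) • ζ.c)
  fun_prop

theorem Ac_perturb (t κ : ℝ) : (ζ.perturb t κ).Ac = ζ.Ac + (t : ℂ) • 1 := by
  ext i j
  by_cases h : i = j <;> simp [Ac, perturb, h]

theorem resolv_perturb (t κ : ℝ) (z : ℂ) : (ζ.perturb t κ).resolv z = ζ.resolv (z - t) := by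
  rw [resolv, resolv, Ac_perturb, sub_smul]
  congr 1
  abel

theorem inputToState_perturb (t κ : ℝ) (k : ℕ) (s : Fin (k + 1) → ℂ) :
    (ζ.perturb t κ).inputToState k s = ζ.inputToState k (fun j => s j - t) := by
  induction k with
  | zero =>
    simp only [inputToState, resolv_perturb]
    rfl
  | succ k ih =>
    simp only [inputToState, resolv_perturb, ih]
    rfl

theorem transfer_perturb (t κ : ℝ) (k : ℕ) (s : Fin (k + 1) → ℂ) :
    (ζ.perturb t κ).transfer k s = (1 + κ) * ζ.transfer k (fun j => s j - t) := by
  have hc : ∀ i, ((ζ.perturb t κ).c i : ℂ) = (1 + κ) * ζ.c i := fun i => by simp [perturb]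
  simp only [transfer, inputToState_perturb, dotProduct, Finset.mul_sum, hc, mul_assoc]

theorem isStable_perturb {t : ℝ} (ht : ∀ z : ℂ, ζ.Ac.charpoly.IsRoot z → z.re + t < 0) (κ : ℝ) :
    (ζ.perturb t κ).IsStable := by
  intro z hz
  have h : ζ.Ac.charpoly.IsRoot (z - t) := by
    rw [isRoot_charpoly_iff] at hz ⊢
    rw [← hz, Ac_perturb, sub_smul]
    congr 1
    abel
  simpa using ht _ h

end BilinearSystem

/-! ### Partial fractions and residues -/

/-- A combination of products of simple fractions with poles in the list `lam`. -/
noncomputable def poleSum {r : ℕ} (lam : Fin r → ℂ) {k : ℕ} (φ : (Fin k → Fin r) → ℂ)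
    (s : Fin k → ℂ) : ℂ :=
  ∑ l : Fin k → Fin r, φ l * ∏ j, (s j - lam (l j))⁻¹

section SumSplit

variable {r k : ℕ} {M : Type*} [AddCommMonoid M]

theorem sum_cons (f : (Fin (k + 1) → Fin r) → M) :
    ∑ l, f l = ∑ i : Fin r, ∑ l : Fin k → Fin r, f (Fin.cons (α := fun _ => Fin r) i l) := by
  rw [← Fintype.sum_prod_type']
  exact (Fintype.sum_equiv (Fin.consEquiv fun _ => Fin r) _ _ fun _ => rfl).symm

theorem sum_snoc (f : (Fin (k + 1) → Fin r) → M) :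
    ∑ l, f l = ∑ i : Fin r, ∑ l : Fin k → Fin r, f (Fin.snoc (α := fun _ => Fin r) l i) := by
  rw [← Fintype.sum_prod_type']
  exact (Fintype.sum_equiv (Fin.snocEquiv fun _ => Fin r) _ _ fun _ => rfl).symm

variable (lam : Fin r → ℂ) (φ : (Fin (k + 1) → Fin r) → ℂ)

theorem poleSum_cons (z : ℂ) (t : Fin k → ℂ) :
    poleSum lam φ (Fin.cons (α := fun _ => ℂ) z t) = ∑ i, (z - lam i)⁻¹ *
      poleSum lam (fun l => φ (Fin.cons (α := fun _ => Fin r) i l)) t := by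
  simp only [poleSum, sum_cons, Fin.prod_univ_succ, Fin.cons_zero, Fin.cons_succ, Finset.mul_sum]
  refine Finset.sum_congr rfl fun i _ => Finset.sum_congr rfl fun l _ => by ring

theorem poleSum_snoc (s : Fin k → ℂ) (z : ℂ) :
    poleSum lam φ (Fin.snoc (α := fun _ => ℂ) s z) = ∑ i,
      poleSum lam (fun l => φ (Fin.snoc (α := fun _ => Fin r) l i)) s * (z - lam i)⁻¹ := by
  simp only [poleSum, sum_snoc, Fin.prod_univ_castSucc, Fin.snoc_castSucc, Fin.snoc_last,
    Finset.sum_mul]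
  refine Finset.sum_congr rfl fun i _ => Finset.sum_congr rfl fun l _ => by ring

/-- Freezing the last variable stays within the class of pole sums, as the tensorization requires.
-/
theorem poleSum_snoc' (s : Fin k → ℂ) (z : ℂ) :
    poleSum lam φ (Fin.snoc (α := fun _ => ℂ) s z) = poleSum lam
      (fun l => ∑ i, φ (Fin.snoc (α := fun _ => Fin r) l i) * (z - lam i)⁻¹) s := by
  rw [poleSum_snoc]
  simp only [poleSum, Finset.sum_mul]
  rw [Finset.sum_comm]
  refine Finset.sum_congr rfl fun i _ => Finset.sum_congr rfl fun l _ => by ring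

end SumSplit

/-- The innermost limit kills every term whose first pole is not `lam (m 0)` and leaves a pole sum
in the remaining variables. Agreement off the poles is enough, because the limits are punctured, and
it is all that the induction can pass on. -/
theorem iteratedResidue_eq_of_eq_poleSum {r : ℕ} {lam : Fin r → ℂ} (hlam : Function.Injective lam)
    {k : ℕ} {F : (Fin k → ℂ) → ℂ} {φ : (Fin k → Fin r) → ℂ}
    (hF : ∀ s, (∀ j i, s j ≠ lam i) → F s = poleSum lam φ s) (m : Fin k → Fin r) :
    iteratedResidue k F (fun j => lam (m j)) = φ m := by
  induction k with
  | zero =>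
    have h0 : ∀ l, φ l = φ m := fun l => congrArg φ (Subsingleton.elim _ _)
    simp only [iteratedResidue]
    rw [hF _ fun j => j.elim0, poleSum]
    simp [h0]
  | succ k ih =>
    simp only [iteratedResidue]
    have h1 := ih (m := Fin.tail m)
      (F := fun t : Fin k → ℂ => limUnder (𝓝[≠] (lam (m 0)))
        (fun z : ℂ => (z - lam (m 0)) * F (Fin.cons z t : Fin (k + 1) → ℂ)))
      (φ := fun l => φ (Fin.cons (α := fun _ => Fin r) (m 0) l)) ?_
    · refine h1.trans ?_
      exact congrArg φ (Fin.cons_self_tail m)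
    intro t ht
    refine Tendsto.limUnder_eq ?_
    have hev : ∀ᶠ z in 𝓝[≠] (lam (m 0)), ∀ i, z ≠ lam i := by
      refine eventually_all.2 fun i => ?_
      by_cases h : i = m 0
      · rw [h]
        exact eventually_mem_nhdsWithin
      · exact ((continuous_id.tendsto (lam (m 0))).eventually_ne
          fun h' => h (hlam h').symm).filter_mono nhdsWithin_le_nhds
    have hlim : Tendsto (fun z => ∑ i, ((z - lam (m 0)) * (z - lam i)⁻¹) *
        poleSum lam (fun l => φ (Fin.cons (α := fun _ => Fin r) i l)) t) (𝓝[≠] (lam (m 0)))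
        (𝓝 (∑ i, (if i = m 0 then 1 else 0) *
          poleSum lam (fun l => φ (Fin.cons (α := fun _ => Fin r) i l)) t)) := by
      refine tendsto_finsetSum _ fun i _ => Tendsto.mul_const _ ?_
      split_ifs with h
      · refine tendsto_const_nhds.congr' ?_
        filter_upwards [eventually_mem_nhdsWithin] with z hz
        rw [h, mul_inv_cancel₀ (sub_ne_zero.2 hz)]
      · have hne : lam (m 0) - lam i ≠ 0 := sub_ne_zero.2 fun h' => h (hlam h').symm
        have hc : ContinuousAt (fun z => (z - lam (m 0)) * (z - lam i)⁻¹) (lam (m 0)) := by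
          fun_prop (disch := exact hne)
        have := hc.tendsto
        simp only [sub_self, zero_mul] at this
        exact this.mono_left nhdsWithin_le_nhds
    simp only [ite_mul, one_mul, zero_mul, Finset.sum_ite_eq', Finset.mem_univ, if_true] at hlim
    refine hlim.congr' ?_
    filter_upwards [hev] with z hz
    rw [hF, poleSum_cons, Finset.mul_sum]
    · simp only [mul_assoc]
    · intro j i
      refine Fin.cases ?_ (fun j => ?_) j
      · simpa using hz i
      · simpa using ht j i

namespace BilinearSystem

variable {r : ℕ} (ζ : BilinearSystem r) (lam : Fin r → ℂ)

/-- The spectral projections of `A` when its eigenvalues are simple. -/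
noncomputable def spectralProj (i : Fin r) : Matrix (Fin r) (Fin r) ℂ :=
  Polynomial.aeval ζ.Ac (Lagrange.basis Finset.univ lam i)

/-- The coefficients of the simple fraction expansion of `inputToState`. -/
noncomputable def stateCoeff : (k : ℕ) → (Fin (k + 1) → Fin r) → (Fin r → ℂ)
  | 0, l => ζ.spectralProj lam (l 0) *ᵥ (fun i => (ζ.b i : ℂ))
  | k + 1, l => ζ.spectralProj lam (l (Fin.last (k + 1))) *ᵥ (ζ.Nc *ᵥ stateCoeff k (Fin.init l))

/-- The coefficients of the simple fraction expansion of the transfer functions. -/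
noncomputable def transferCoeff (k : ℕ) (l : Fin (k + 1) → Fin r) : ℂ :=
  (fun i => (ζ.c i : ℂ)) ⬝ᵥ ζ.stateCoeff lam k l

variable {ζ lam}

theorem HasSimplePoles.sum_spectralProj (h : ζ.HasSimplePoles lam) :
    ∑ i, ζ.spectralProj lam i = 1 := by
  rcases isEmpty_or_nonempty (Fin r) with he | he
  · exact Subsingleton.elim _ _
  · simp only [spectralProj]
    rw [← map_sum, Lagrange.sum_basis h.1.injOn Finset.univ_nonempty, map_one]

/-- `X - C (lam i)` times the i-th Lagrange polynomial is a constant multiple of the characteristic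
polynomial, which annihilates `A` by Cayley–Hamilton. -/
theorem HasSimplePoles.mul_spectralProj (h : ζ.HasSimplePoles lam) (i : Fin r) :
    ζ.Ac * ζ.spectralProj lam i = lam i • ζ.spectralProj lam i := by
  have h1 : (Polynomial.X - Polynomial.C (lam i)) * Lagrange.basis Finset.univ lam i =
      (∏ j ∈ Finset.univ.erase i, Polynomial.C ((lam i - lam j)⁻¹)) * ζ.Ac.charpoly := by
    rw [h.2, ← Finset.mul_prod_erase Finset.univ _ (Finset.mem_univ i)]
    simp only [Lagrange.basis, Lagrange.basisDivisor, Finset.prod_mul_distrib]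
    ring
  have h2 := congrArg (Polynomial.aeval ζ.Ac) h1
  rw [map_mul, map_mul, Matrix.aeval_self_charpoly, mul_zero, map_sub, Polynomial.aeval_X,
    Polynomial.aeval_C, sub_mul, sub_eq_zero, Algebra.algebraMap_eq_smul_one, smul_mul_assoc,
    one_mul] at h2
  exact h2

theorem HasSimplePoles.resolv_eq (h : ζ.HasSimplePoles lam) {z : ℂ} (hz : ∀ i, z ≠ lam i) :
    ζ.resolv z = ∑ i, (z - lam i)⁻¹ • ζ.spectralProj lam i := by
  refine Matrix.inv_eq_right_inv ?_
  rw [Finset.mul_sum]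
  refine Eq.trans ?_ h.sum_spectralProj
  refine Finset.sum_congr rfl fun i _ => ?_
  rw [mul_smul_comm, sub_mul, h.mul_spectralProj, smul_mul_assoc, one_mul, ← sub_smul, smul_smul,
    inv_mul_cancel₀ (sub_ne_zero.2 (hz i)), one_smul]

theorem HasSimplePoles.inputToState_eq (h : ζ.HasSimplePoles lam) (k : ℕ) (s : Fin (k + 1) → ℂ)
    (hs : ∀ j i, s j ≠ lam i) :
    ζ.inputToState k s = ∑ l, (∏ j, (s j - lam (l j))⁻¹) • ζ.stateCoeff lam k l := by
  induction k with
  | zero =>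
    rw [sum_snoc]
    simp only [inputToState, h.resolv_eq (hs 0), Matrix.sum_mulVec, Matrix.smul_mulVec]
    simp [stateCoeff, Fin.snoc]
  | succ k ih =>
    rw [sum_snoc]
    have h1 := ih (Fin.init s) fun j i => hs _ i
    simp only [inputToState, h.resolv_eq (hs _), h1, Matrix.sum_mulVec,
      Matrix.smul_mulVec, Matrix.mulVec_sum, Matrix.mulVec_smul, Finset.smul_sum, smul_smul]
    rw [Finset.sum_comm]
    refine Finset.sum_congr rfl fun i _ => Finset.sum_congr rfl fun l _ => ?_
    rw [Fin.prod_univ_castSucc (n := k + 1)]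
    simp only [Fin.snoc_castSucc, Fin.snoc_last, stateCoeff, Fin.init_snoc]
    rfl

theorem HasSimplePoles.transfer_eq (h : ζ.HasSimplePoles lam) (k : ℕ) (s : Fin (k + 1) → ℂ)
    (hs : ∀ j i, s j ≠ lam i) : ζ.transfer k s = poleSum lam (ζ.transferCoeff lam k) s := by
  rw [transfer, h.inputToState_eq k s hs, dotProduct_sum, poleSum]
  refine Finset.sum_congr rfl fun l _ => ?_
  rw [dotProduct_smul, smul_eq_mul, mul_comm]
  rfl

theorem HasSimplePoles.residue_eq (h : ζ.HasSimplePoles lam) (k : ℕ) (l : Fin (k + 1) → Fin r) :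
    ζ.residue lam k l = ζ.transferCoeff lam k l :=
  iteratedResidue_eq_of_eq_poleSum h.1 (h.transfer_eq k) l

theorem HasSimplePoles.isRoot_iff (h : ζ.HasSimplePoles lam) (z : ℂ) :
    ζ.Ac.charpoly.IsRoot z ↔ ∃ i, z = lam i := by
  rw [h.2, Polynomial.IsRoot, Polynomial.eval_prod, Finset.prod_eq_zero_iff]
  simp [sub_eq_zero]

variable (ζ lam) in
/-- The linear map `X ↦ ∑ᵢ Pᵢ N X Nᵀ (-λᵢ I - A)⁻ᵀ`. -/
noncomputable def gramStep : Module.End ℂ (Matrix (Fin r) (Fin r) ℂ) where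
  toFun X := ∑ i, ζ.spectralProj lam i * ζ.Nc * X * (ζ.resolv (-lam i) * ζ.Nc)ᵀ
  map_add' X Y := by simp only [mul_add, add_mul, Finset.sum_add_distrib]
  map_smul' a X := by simp [Finset.smul_sum]

-- Passing from k to k + 1 prolongs both factors of each outer product by the same last index, so
-- the new sum is linear in the old one. The map does not depend on k: the energies of all orders
-- thus come from a single recursion on r × r matrices.
variable (ζ lam) in
theorem sum_vecMulVec_eq_gramStep_pow (k : ℕ) :
    ∑ l, Matrix.vecMulVec (ζ.stateCoeff lam k l) (ζ.inputToState k fun j => -lam (l j)) =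
      (ζ.gramStep lam ^ k) (∑ l, Matrix.vecMulVec (ζ.stateCoeff lam 0 l)
        (ζ.inputToState 0 fun j => -lam (l j))) := by
  induction k with
  | zero => simp
  | succ k ih =>
    rw [pow_succ', Module.End.mul_apply, ← ih, sum_snoc]
    change _ = ∑ i, ζ.spectralProj lam i * ζ.Nc * _ * (ζ.resolv (-lam i) * ζ.Nc)ᵀ
    refine Finset.sum_congr rfl fun i _ => ?_
    rw [Finset.mul_sum, Finset.sum_mul]
    refine Finset.sum_congr rfl fun l _ => ?_
    rw [Matrix.mul_vecMulVec, Matrix.vecMulVec_mul, Matrix.vecMul_transpose]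
    simp only [stateCoeff, inputToState, Fin.snoc_last, Fin.init_snoc, Matrix.mulVec_mulVec]
    congr 3
    funext j
    simp [Fin.init]

variable (ζ lam) in
/-- The pairing of the transfer functions with themselves has a finite-dimensional recursion. -/
theorem sum_transferCoeff_mul_transfer (k : ℕ) :
    ∑ l, ζ.transferCoeff lam k l * ζ.transfer k (fun j => -lam (l j)) =
      (fun i => (ζ.c i : ℂ)) ⬝ᵥ ((ζ.gramStep lam ^ k) (∑ l, Matrix.vecMulVec (ζ.stateCoeff lam 0 l)
        (ζ.inputToState 0 fun j => -lam (l j))) *ᵥ fun i => (ζ.c i : ℂ)) := by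
  rw [← sum_vecMulVec_eq_gramStep_pow, Matrix.sum_mulVec, dotProduct_sum]
  refine Finset.sum_congr rfl fun l _ => ?_
  rw [Matrix.vecMulVec_mulVec, transferCoeff, transfer, dotProduct_comm _ (ζ.inputToState _ _)]
  simp [mul_comm]

end BilinearSystem

/-! ### Geometric decay of null sequences from linear recursions -/

open scoped Matrix.Norms.Operator in
/-- The powers of a complex matrix whose eigenvalues lie in the open unit disc decay geometrically. -/
theorem Matrix.exists_norm_pow_le {d : ℕ} (M : Matrix (Fin d) (Fin d) ℂ)
    (hM : ∀ z ∈ spectrum ℂ M, ‖z‖ < 1) :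
    ∃ C ρ : ℝ, 0 < ρ ∧ ρ < 1 ∧ ∀ k : ℕ, ∀ i j, ‖(M ^ k) i j‖ ≤ C * ρ ^ k := by
  rcases isEmpty_or_nonempty (Fin d) with he | he
  · exact ⟨0, 1 / 2, by norm_num, by norm_num, fun k i => he.elim i⟩
  have hlt : spectralRadius ℂ M < 1 := by
    refine spectrum.spectralRadius_lt_of_forall_lt M (r := 1) fun z hz => ?_
    exact_mod_cast hM z hz
  obtain ⟨ρ, h1, h2⟩ := ENNReal.lt_iff_exists_nnreal_btwn.1 hlt
  have hρ0 : 0 < ρ := by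
    by_contra h
    rw [not_lt, nonpos_iff_eq_zero] at h
    simp [h] at h1
  have hev := (spectrum.pow_nnnorm_pow_one_div_tendsto_nhds_spectralRadius M).eventually_lt_const h1
  obtain ⟨K, hK⟩ := eventually_atTop.1 (hev.and (eventually_ge_atTop 1))
  have hbig : ∀ k ≥ K, ‖M ^ k‖ ≤ (ρ : ℝ) ^ k := by
    intro k hk
    obtain ⟨h3, h4⟩ := hK k hk
    have hk0 : (0 : ℝ) < k := by exact_mod_cast h4
    have h5 := ENNReal.rpow_le_rpow h3.le hk0.le
    rw [← ENNReal.rpow_mul, one_div, inv_mul_cancel₀ hk0.ne', ENNReal.rpow_one,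
      ENNReal.rpow_natCast] at h5
    exact_mod_cast h5
  have hρ1 : (ρ : ℝ) < 1 := by exact_mod_cast h2
  -- Gelfand's formula gives the bound with constant 1 from `K` on; the finite sum absorbs the
  -- earlier powers.
  refine ⟨1 + ∑ k ∈ Finset.range K, ‖M ^ k‖ / (ρ : ℝ) ^ k, ρ, hρ0, hρ1, fun k i j => ?_⟩
  have hentry : ‖(M ^ k) i j‖ ≤ ‖M ^ k‖ := by
    have := Matrix.linfty_opNorm_mulVec (M ^ k) (Pi.single j 1)
    have h6 := norm_le_pi_norm ((M ^ k) *ᵥ (Pi.single j 1)) i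
    simp only [Matrix.mulVec_single_one, Matrix.col_apply] at h6 this
    refine h6.trans (this.trans ?_)
    rw [Pi.norm_single]
    simp
  refine hentry.trans ?_
  have hρk : (0 : ℝ) < (ρ : ℝ) ^ k := by positivity
  rw [← div_le_iff₀ hρk]
  have hnn : ∀ m ∈ Finset.range K, 0 ≤ ‖M ^ m‖ / (ρ : ℝ) ^ m := fun m _ => by positivity
  rcases lt_or_ge k K with h | h
  · have := Finset.single_le_sum hnn (Finset.mem_range.2 h)
    linarith
  · have h7 : ‖M ^ k‖ / (ρ : ℝ) ^ k ≤ 1 := (div_le_one hρk).2 (hbig k h)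
    have := Finset.sum_nonneg hnn
    linarith

/-- The shift of complex sequences. -/
def seqShift : Module.End ℂ (ℕ → ℂ) where
  toFun a k := a (k + 1)
  map_add' _ _ := rfl
  map_smul' _ _ := rfl

theorem seqShift_pow_apply (a : ℕ → ℂ) (k m : ℕ) : (seqShift ^ k) a m = a (k + m) := by
  induction k generalizing a with
  | zero => simp
  | succ k ih =>
    rw [pow_succ, Module.End.mul_apply, ih]
    exact congrArg a (by ring)

/-- A null sequence generated by a finite-dimensional linear recursion decays geometrically. -/
theorem exists_geometric_bound {V : Type*} [AddCommGroup V] [Module ℂ V] [FiniteDimensional ℂ V]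
    (T : Module.End ℂ V) (ℓ : V →ₗ[ℂ] ℂ) (v : V)
    (h0 : Tendsto (fun k => ℓ ((T ^ k) v)) atTop (𝓝 0)) :
    ∃ C ρ : ℝ, 0 < ρ ∧ ρ < 1 ∧ ∀ k : ℕ, ‖ℓ ((T ^ k) v)‖ ≤ C * ρ ^ k := by
  -- `T` itself may have eigenvalues outside the unit disc that `ℓ` does not see. The observability
  -- map `Ob` passes to output sequences, where `T` becomes the shift.
  set Ob : V →ₗ[ℂ] (ℕ → ℂ) := LinearMap.pi fun k => ℓ ∘ₗ (T ^ k) with hOb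
  have hObshift : ∀ k w, (seqShift ^ k) (Ob w) = Ob ((T ^ k) w) := by
    intro k w
    ext m
    rw [seqShift_pow_apply]
    simp only [hOb, LinearMap.pi_apply, LinearMap.comp_apply]
    rw [add_comm, pow_add, Module.End.mul_apply]
  set a : ℕ → ℂ := Ob v with ha
  -- The shift-invariant space generated by the output sequence: finite-dimensional because it lies
  -- in the range of `Ob`, and made of null sequences only.
  set E : Submodule ℂ (ℕ → ℂ) := Submodule.span ℂ (Set.range fun k => (seqShift ^ k) a) with hE
  have hle : E ≤ Ob.range := by
    rw [hE, Submodule.span_le]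
    rintro _ ⟨k, rfl⟩
    exact ⟨(T ^ k) v, (hObshift k v).symm⟩
  have hfin : FiniteDimensional ℂ E := Submodule.finiteDimensional_of_le hle
  have haE : a ∈ E := Submodule.subset_span ⟨0, by simp⟩
  have hinv : ∀ x ∈ E, seqShift x ∈ E := by
    intro x hx
    induction hx using Submodule.span_induction with
    | mem x h =>
      obtain ⟨k, rfl⟩ := h
      refine Submodule.subset_span ⟨k + 1, ?_⟩
      simp only [pow_succ', Module.End.mul_apply]
    | zero => simp
    | add x y _ _ h1 h2 => rw [map_add]; exact E.add_mem h1 h2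
    | smul c x _ h => rw [map_smul]; exact E.smul_mem c h
  have hnull : ∀ x ∈ E, Tendsto x atTop (𝓝 0) := by
    intro x hx
    induction hx using Submodule.span_induction with
    | mem x h =>
      obtain ⟨k, rfl⟩ := h
      have h1 : (seqShift ^ k) a = fun m => ℓ ((T ^ (m + k)) v) := by
        ext m
        rw [seqShift_pow_apply, add_comm]
        rfl
      change Tendsto ((seqShift ^ k) a) atTop (𝓝 0)
      rw [h1]
      exact h0.comp (tendsto_add_atTop_nat k)
    | zero => exact tendsto_const_nhds
    | add x y _ _ h1 h2 =>
      have := h1.add h2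
      rw [add_zero] at this
      exact this
    | smul c x _ h =>
      have := h.const_mul c
      rw [mul_zero] at this
      exact this
  set S : Module.End ℂ E := seqShift.restrict hinv with hS
  have hSpow : ∀ k (x : E), (((S ^ k) x : E) : ℕ → ℂ) = (seqShift ^ k) (x : ℕ → ℂ) := by
    intro k
    induction k with
    | zero => simp
    | succ k ih =>
      intro x
      rw [pow_succ, Module.End.mul_apply, ih, pow_succ, Module.End.mul_apply]
      rfl
  -- An eigenvector of the shift is a nonzero geometric sequence of ratio `z`, and it must tend to
  -- 0.
  have hspec : ∀ z ∈ spectrum ℂ S, ‖z‖ < 1 := by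
    intro z hz
    obtain ⟨x, hx⟩ := (Module.End.hasEigenvalue_iff_mem_spectrum.2 hz).exists_hasEigenvector
    have hx0 : (x : ℕ → ℂ) ≠ 0 := fun h => hx.2 (Subtype.ext h)
    obtain ⟨m, hm⟩ := Function.ne_iff.1 hx0
    have h1 : ∀ k, (x : ℕ → ℂ) (k + m) = z ^ k * (x : ℕ → ℂ) m := by
      intro k
      have h2 := hx.pow_apply k
      have h3 := congrFun (congrArg Subtype.val h2) m
      rw [hSpow, seqShift_pow_apply] at h3
      simpa using h3
    have h2 : Tendsto (fun k => (x : ℕ → ℂ) (k + m)) atTop (𝓝 0) :=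
      (hnull _ x.2).comp (tendsto_add_atTop_nat m)
    simp_rw [h1] at h2
    have h3 := h2.mul_const ((x : ℕ → ℂ) m)⁻¹
    simp_rw [mul_assoc, mul_inv_cancel₀ hm, mul_one, zero_mul] at h3
    have h4 := h3.norm
    simp only [norm_pow, norm_zero] at h4
    have h5 := (tendsto_pow_atTop_nhds_zero_iff (r := ‖z‖)).1 h4
    simpa using h5
  set B := Module.finBasis ℂ E with hB
  set M := LinearMap.toMatrixAlgEquiv B S with hM
  obtain ⟨C, ρ, hρ0, hρ1, hbound⟩ := Matrix.exists_norm_pow_le M fun z hz => by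
    rw [hM, AlgEquiv.spectrum_eq] at hz
    exact hspec z hz
  refine ⟨∑ i, (∑ j, C * ‖B.repr ⟨a, haE⟩ j‖) * ‖(B i : ℕ → ℂ) 0‖, ρ, hρ0, hρ1, fun k => ?_⟩
  have h1 : ℓ ((T ^ k) v) = (((S ^ k) ⟨a, haE⟩ : E) : ℕ → ℂ) 0 := by
    rw [hSpow, seqShift_pow_apply, add_zero]
    rfl
  have h2 : ∀ i, B.repr ((S ^ k) ⟨a, haE⟩) i = ∑ j, (M ^ k) i j * B.repr ⟨a, haE⟩ j := by
    intro i
    rw [hM, ← map_pow]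
    exact (congrFun (LinearMap.toMatrix_mulVec_repr B B (S ^ k) ⟨a, haE⟩) i).symm
  have h3 : (((S ^ k) ⟨a, haE⟩ : E) : ℕ → ℂ) 0 =
      ∑ i, B.repr ((S ^ k) ⟨a, haE⟩) i * (B i : ℕ → ℂ) 0 := by
    have h4 := congrFun (congrArg Subtype.val (B.sum_repr ((S ^ k) ⟨a, haE⟩))) 0
    rw [← h4, AddSubmonoidClass.coe_finsetSum, Finset.sum_apply]
    rfl
  rw [h1, h3, Finset.sum_mul]
  refine (norm_sum_le _ _).trans (Finset.sum_le_sum fun i _ => ?_)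
  rw [norm_mul, h2, mul_right_comm, Finset.sum_mul]
  gcongr
  refine (norm_sum_le _ _).trans (Finset.sum_le_sum fun j _ => ?_)
  rw [norm_mul, mul_right_comm]
  gcongr
  exact hbound k i j

/-! ### Stability of simple fractions under small shifts, in L² -/

section SimpleFractions

variable {r : ℕ} {lam : Fin r → ℂ}

/-- Simple fractions with distinct poles are linearly independent on any infinite set. -/
theorem eq_zero_of_sum_inv_sub_eq_zero (hinj : Function.Injective lam) {α : Fin r → ℂ} {U : Set ℂ}
    (hU : U.Infinite) (hpole : ∀ z ∈ U, ∀ i, z ≠ lam i)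
    (h : ∀ z ∈ U, ∑ i, α i * (z - lam i)⁻¹ = 0) : α = 0 := by
  -- The numerator after clearing denominators; it vanishes identically, and its value at `lam i` is
  -- a nonzero multiple of `α i`.
  set p : Polynomial ℂ := ∑ i, Polynomial.C (α i) *
    ∏ j ∈ Finset.univ.erase i, (Polynomial.X - Polynomial.C (lam j)) with hp
  have heval : ∀ z, p.eval z = ∑ i, α i * ∏ j ∈ Finset.univ.erase i, (z - lam j) := fun z => by
    simp [hp, Polynomial.eval_finsetSum, Polynomial.eval_prod]
  have hp0 : p = 0 := by
    refine Polynomial.eq_zero_of_infinite_isRoot p (hU.mono fun z hz => ?_)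
    change p.eval z = 0
    have h1 : ∀ i, ∏ j ∈ Finset.univ.erase i, (z - lam j) =
        (z - lam i)⁻¹ * ∏ j, (z - lam j) := fun i => by
      rw [← Finset.mul_prod_erase Finset.univ _ (Finset.mem_univ i),
        inv_mul_cancel_left₀ (sub_ne_zero.2 (hpole z hz i))]
    rw [heval]
    simp_rw [h1, ← mul_assoc]
    rw [← Finset.sum_mul, h z hz, zero_mul]
  ext i
  have h2 := heval (lam i)
  rw [hp0, Polynomial.eval_zero, Finset.sum_eq_single i] at h2
  · have h3 : ∏ j ∈ Finset.univ.erase i, (lam i - lam j) ≠ 0 :=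
      Finset.prod_ne_zero_iff.2 fun j hj => sub_ne_zero.2 fun h' => Finset.ne_of_mem_erase hj (hinj h').symm
    exact (mul_eq_zero.1 h2.symm).resolve_right h3
  · intro j _ hj
    rw [Finset.prod_eq_zero (i := i) (by simp [hj.symm]) (sub_self _), mul_zero]
  · simp

theorem memLp_two_of_norm_le {h : ℝ → ℂ} (hc : Continuous h) {C : ℝ}
    (hb : ∀ y, ‖h y‖ ≤ C * (1 + |y|)⁻¹) : MemLp h 2 := by
  rw [memLp_two_iff_integrable_sq_norm hc.aestronglyMeasurable]
  refine integrable_of_norm_le_inv_sq (C := C * C) (by fun_prop) fun y => ?_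
  rw [norm_pow, norm_norm, pow_two]
  refine (mul_self_le_mul_self (norm_nonneg _) (hb y)).trans (le_of_eq ?_)
  ring

theorem eLpNorm_two_sq (h : ℝ → ℂ) : eLpNorm h 2 volume ^ 2 = ∫⁻ y, ‖h y‖ₑ ^ 2 := by
  rw [eLpNorm_eq_lintegral_rpow_enorm_toReal two_ne_zero ENNReal.ofNat_ne_top]
  simp only [ENNReal.toReal_ofNat, ENNReal.rpow_ofNat]
  rw [← ENNReal.rpow_two, ← ENNReal.rpow_mul]
  norm_num

theorem memLp_inv_sub {μ : ℂ} (hμ : 0 < μ.re) :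
    MemLp (fun y : ℝ => (μ - y * Complex.I)⁻¹) 2 :=
  memLp_two_of_norm_le (IsHardyOne.continuous_inv_sub hμ) (IsHardyOne.norm_inv_sub_le hμ)

theorem memLp_sum_inv_sub {μ : Fin r → ℂ} (hμ : ∀ i, 0 < (μ i).re) (α : Fin r → ℂ) :
    MemLp (fun y : ℝ => ∑ i, α i * (μ i - y * Complex.I)⁻¹) 2 :=
  memLp_finsetSum _ fun i _ => (memLp_inv_sub (hμ i)).const_mul (α i)

/-- The coefficients of a combination of simple fractions are controlled by its `L²` norm. -/
theorem exists_norm_coeff_le (hinj : Function.Injective lam) (hre : ∀ i, (lam i).re < 0) :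
    ∃ K : ℝ, 0 ≤ K ∧ ∀ α : Fin r → ℂ, ENNReal.ofReal ‖α‖ ≤ ENNReal.ofReal K *
      eLpNorm (fun y : ℝ => ∑ i, α i * (-lam i - y * Complex.I)⁻¹) 2 volume := by
  have hμ : ∀ i, 0 < (-lam i).re := fun i => by simpa using hre i
  set L : (Fin r → ℂ) →ₗ[ℂ] Lp ℂ 2 (volume : Measure ℝ) :=
    { toFun := fun α => (memLp_sum_inv_sub hμ α).toLp
      map_add' := fun α β => by
        rw [← MemLp.toLp_add]
        refine MemLp.toLp_congr _ _ (ae_of_all _ fun y => ?_)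
        simp [add_mul, Finset.sum_add_distrib]
      map_smul' := fun c α => by
        rw [RingHom.id_apply, ← MemLp.toLp_const_smul]
        refine MemLp.toLp_congr _ _ (ae_of_all _ fun y => ?_)
        simp [Finset.mul_sum, mul_assoc] } with hL
  have hker : L.ker = ⊥ := by
    rw [LinearMap.ker_eq_bot']
    intro α hα
    have h1 : (fun y : ℝ => ∑ i, α i * (-lam i - y * Complex.I)⁻¹) =ᵐ[volume] fun _ => 0 :=
      (MemLp.toLp_eq_toLp_iff (memLp_sum_inv_sub hμ α) MemLp.zero').1 (hα.trans (MemLp.toLp_zero _).symm)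
    have hc : Continuous (fun y : ℝ => ∑ i, α i * (-lam i - y * Complex.I)⁻¹) :=
      continuous_finsetSum _ fun i _ => continuous_const.mul (IsHardyOne.continuous_inv_sub (hμ i))
    have h2 := (hc.ae_eq_iff_eq volume continuous_const).1 h1
    refine eq_zero_of_sum_inv_sub_eq_zero hinj (U := Set.range fun y : ℝ => -(y * Complex.I)) ?_ ?_ ?_
    · refine Set.infinite_range_of_injective fun y y' h => ?_
      simpa using h
    · rintro _ ⟨y, rfl⟩ i h
      have := congrArg Complex.re h
      simp at this
      linarith [hre i]
    · rintro _ ⟨y, rfl⟩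
      rw [← congrFun h2 y]
      refine Finset.sum_congr rfl fun i _ => ?_
      congr 2
      ring
  -- An injective linear map out of a finite-dimensional space is bounded below.
  obtain ⟨K, -, hK⟩ := L.exists_antilipschitzWith hker
  refine ⟨K, K.2, fun α => ?_⟩
  have h1 := hK.le_mul_dist α 0
  rw [map_zero, dist_zero_right, dist_zero_right] at h1
  have h2 := ENNReal.ofReal_le_ofReal h1
  rw [ENNReal.ofReal_mul K.coe_nonneg, ofReal_norm (L α)] at h2
  refine h2.trans (le_of_eq ?_)
  congr 1
  exact Lp.enorm_toLp (memLp_sum_inv_sub hμ α)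

/-- A small shift changes the `L²` norm of a combination of simple fractions by a factor close to
one, uniformly in the coefficients. -/
theorem exists_lintegral_shift_le (hinj : Function.Injective lam) (hre : ∀ i, (lam i).re < 0)
    {q : ℝ} (hq : 1 < q) : ∃ δ > 0, ∀ t : ℂ, ‖t‖ < δ → ∀ α : Fin r → ℂ,
      ∫⁻ y : ℝ, ‖∑ i, α i * (-t - y * Complex.I - lam i)⁻¹‖ₑ ^ 2 ≤
        ENNReal.ofReal q * ∫⁻ y : ℝ, ‖∑ i, α i * (-(y * Complex.I) - lam i)⁻¹‖ₑ ^ 2 := by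
  have hμ : ∀ i, 0 < (-lam i).re := fun i => by simpa using hre i
  obtain ⟨K, hK0, hK⟩ := exists_norm_coeff_le hinj hre
  set D : Fin r → ℝ := fun i => (1 + ‖-lam i‖) / (-lam i).re + 1 with hD
  have hD0 : ∀ i, 1 ≤ D i := fun i => by
    have := hμ i
    simp only [hD]
    linarith [show 0 ≤ (1 + ‖-lam i‖) / (-lam i).re by positivity]
  have hDb : ∀ i (y : ℝ), ‖(-lam i - y * Complex.I)⁻¹‖ ≤ D i * (1 + |y|)⁻¹ :=
    fun i => IsHardyOne.norm_inv_sub_le (hμ i)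
  set u : ℝ → ℂ := fun y => (((1 + |y|)⁻¹ : ℝ) : ℂ) with hu
  have huc : Continuous u := by
    have : ∀ y : ℝ, 1 + |y| ≠ 0 := fun y => by positivity
    exact Complex.continuous_ofReal.comp (by fun_prop (disch := exact this _))
  have huL : MemLp u 2 := memLp_two_of_norm_le (C := 1) huc fun y => by
    rw [hu, Complex.norm_real, Real.norm_of_nonneg (by positivity), one_mul]
  set B : ℝ := ∑ i, 2 * (D i * D i) with hB
  have hB0 : 0 ≤ B := Finset.sum_nonneg fun i _ => by nlinarith [hD0 i]
  set W : ℝ := (eLpNorm u 2 volume).toReal with hW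
  have hWe : eLpNorm u 2 volume = ENNReal.ofReal W := (ENNReal.ofReal_toReal huL.2.ne).symm
  -- The difference of shifted and unshifted kernels is `t` times their product, at most 2 Dᵢ² ‖t‖ /
  -- (1 + |y|) once ‖t‖ is at most half the distance from the poles to the axis. Here `B` sums these
  -- constants, `W` is the L² norm of 1 / (1 + |y|), and `K` returns from the coefficients to the
  -- norm of `f`. Hence ‖g‖ ≤ (1 + C‖t‖) ‖f‖.
  set C : ℝ := B * W * K with hC
  have hC0 : 0 ≤ C := mul_nonneg (mul_nonneg hB0 ENNReal.toReal_nonneg) hK0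
  have hev : ∀ᶠ t : ℂ in 𝓝 0, (1 + C * ‖t‖) ^ 2 ≤ q := by
    have hcont : Continuous fun t : ℂ => (1 + C * ‖t‖) ^ 2 := by fun_prop
    exact (hcont.tendsto' 0 1 (by simp)).eventually_le_const hq
  have hev2 : ∀ᶠ t : ℂ in 𝓝 0, ∀ i, 2 * ‖t‖ ≤ (-lam i).re := by
    refine eventually_all.2 fun i => ?_
    have hcont : Continuous fun t : ℂ => 2 * ‖t‖ := by fun_prop
    exact (hcont.tendsto' 0 0 (by simp)).eventually_le_const (hμ i)
  obtain ⟨δ, hδ, hball⟩ := Metric.eventually_nhds_iff.1 (hev.and hev2)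
  refine ⟨δ, hδ, fun t ht α => ?_⟩
  obtain ⟨hq', ht2⟩ := hball (by simpa using ht)
  set f : ℝ → ℂ := fun y => ∑ i, α i * (-lam i - y * Complex.I)⁻¹ with hf
  set g : ℝ → ℂ := fun y => ∑ i, α i * (-lam i - t - y * Complex.I)⁻¹ with hg
  have hμt : ∀ i, 0 < (-lam i - t).re := fun i => by
    have h1 := Complex.re_le_norm t
    have h2 := ht2 i
    have h3 := hμ i
    rw [Complex.sub_re]
    linarith
  have hfL : MemLp f 2 := memLp_sum_inv_sub hμ α
  have hgL : MemLp g 2 := memLp_sum_inv_sub hμt α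
  have hne : ∀ (μ : ℂ), 0 < μ.re → ∀ y : ℝ, μ - y * Complex.I ≠ 0 := fun μ hμ y h => by
    have := congrArg Complex.re h
    simp at this
    linarith
  have hdiff : ∀ y, ‖g y - f y‖ ≤ ‖(((B * ‖t‖ * ‖α‖ : ℝ) : ℂ)) * u y‖ := by
    intro y
    have h1 : ∀ i, ‖α i * (-lam i - t - y * Complex.I)⁻¹ - α i * (-lam i - y * Complex.I)⁻¹‖ ≤
        ‖α‖ * (‖t‖ * (2 * (D i * D i)) * (1 + |y|)⁻¹) := by
      intro i
      have ha := hne _ (hμ i) y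
      have hb := hne _ (hμt i) y
      have e1 : α i * (-lam i - t - y * Complex.I)⁻¹ - α i * (-lam i - y * Complex.I)⁻¹ =
          α i * (t * (-lam i - t - y * Complex.I)⁻¹ * (-lam i - y * Complex.I)⁻¹) := by
        field_simp
        ring
      have e2 : ‖(-lam i - t - y * Complex.I)⁻¹‖ ≤ 2 * ‖(-lam i - y * Complex.I)⁻¹‖ := by
        rw [norm_inv, norm_inv, inv_le_comm₀ (norm_pos_iff.2 hb)
          (mul_pos two_pos (inv_pos.2 (norm_pos_iff.2 ha))), mul_inv, inv_inv]
        have e3 : (-lam i).re ≤ ‖-lam i - y * Complex.I‖ := by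
          refine le_trans ?_ (Complex.re_le_norm _)
          simp
        have e4 := norm_sub_norm_le (-lam i - y * Complex.I) t
        have e5 : -lam i - y * Complex.I - t = -lam i - t - y * Complex.I := by ring
        rw [e5] at e4
        linarith [ht2 i]
      have e6 := hDb i y
      have e7 : (1 + |y|)⁻¹ ≤ 1 := inv_le_one_of_one_le₀ (by linarith [abs_nonneg y])
      have e8 : (0 : ℝ) < (1 + |y|)⁻¹ := by positivity
      have hDi : 0 ≤ D i := zero_le_one.trans (hD0 i)
      rw [e1, norm_mul, norm_mul, norm_mul]
      refine mul_le_mul (norm_le_pi_norm α i) ?_ (by positivity) (norm_nonneg _)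
      calc ‖t‖ * ‖(-lam i - t - y * Complex.I)⁻¹‖ * ‖(-lam i - y * Complex.I)⁻¹‖
          ≤ ‖t‖ * (2 * (D i * 1)) * (D i * (1 + |y|)⁻¹) := by
            gcongr
            refine e2.trans ?_
            gcongr
            exact e6.trans (by gcongr)
        _ = _ := by ring
    have h2 : g y - f y = ∑ i, (α i * (-lam i - t - y * Complex.I)⁻¹ -
        α i * (-lam i - y * Complex.I)⁻¹) := by
      rw [Finset.sum_sub_distrib]
    rw [h2, norm_mul, Complex.norm_real, Real.norm_of_nonneg (by positivity), hu, Complex.norm_real,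
      Real.norm_of_nonneg (by positivity)]
    refine (norm_sum_le _ _).trans ((Finset.sum_le_sum fun i _ => h1 i).trans (le_of_eq ?_))
    rw [hB, ← Finset.mul_sum, ← Finset.sum_mul, ← Finset.mul_sum]
    ring
  have hnorm : eLpNorm g 2 volume ≤ ENNReal.ofReal (1 + C * ‖t‖) * eLpNorm f 2 volume := by
    have h1 : g = f + (g - f) := by ring
    have h2 : eLpNorm (g - f) 2 volume ≤
        ENNReal.ofReal (B * ‖t‖ * ‖α‖) * ENNReal.ofReal W := by
      refine (eLpNorm_mono hdiff).trans (le_of_eq ?_)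
      have := eLpNorm_const_smul (((B * ‖t‖ * ‖α‖ : ℝ) : ℂ)) u 2 volume
      rw [← hWe]
      refine Eq.trans this ?_
      rw [← ofReal_norm, Complex.norm_real, Real.norm_of_nonneg (by positivity)]
    rw [h1]
    refine (eLpNorm_add_le hfL.1 (hgL.1.sub hfL.1) (by norm_num)).trans ?_
    rw [ENNReal.ofReal_add zero_le_one (by positivity), ENNReal.ofReal_one, add_mul, one_mul]
    gcongr
    refine h2.trans ?_
    have h3 : C * ‖t‖ = (B * ‖t‖ * W) * K := by rw [hC]; ring
    have hW0 : 0 ≤ W := ENNReal.toReal_nonneg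
    have h4 : ENNReal.ofReal (B * ‖t‖ * W * K) = ENNReal.ofReal (B * ‖t‖ * W) * ENNReal.ofReal K :=
      ENNReal.ofReal_mul (by positivity)
    rw [h3, h4, mul_assoc (ENNReal.ofReal (B * ‖t‖ * W))]
    refine le_trans (le_of_eq ?_) (mul_le_mul_right (hK α) _)
    rw [← ENNReal.ofReal_mul (by positivity), ← ENNReal.ofReal_mul (by positivity)]
    congr 1
    ring
  have e1 : ∀ y : ℝ, ∑ i, α i * (-t - y * Complex.I - lam i)⁻¹ = g y := fun y => by
    refine Finset.sum_congr rfl fun i _ => ?_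
    congr 2
    ring
  have e2 : ∀ y : ℝ, ∑ i, α i * (-(y * Complex.I) - lam i)⁻¹ = f y := fun y => by
    refine Finset.sum_congr rfl fun i _ => ?_
    congr 2
    ring
  simp_rw [e1, e2]
  rw [← eLpNorm_two_sq, ← eLpNorm_two_sq]
  refine (pow_le_pow_left' hnorm 2).trans ?_
  rw [mul_pow, ← ENNReal.ofReal_pow (by positivity)]
  gcongr

/-- Tensorization of the one-variable estimate. As a function of the last variable a pole sum is a
combination of simple fractions whose coefficients depend on the other variables; uniformity in the
coefficients is what makes `δ` independent of `k` and `φ`. -/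
theorem exists_lintegral_poleSum_shift_le (hinj : Function.Injective lam)
    (hre : ∀ i, (lam i).re < 0) {q : ℝ} (hq : 1 < q) : ∃ δ > 0, ∀ t : ℂ, ‖t‖ < δ →
      ∀ (k : ℕ) (φ : (Fin k → Fin r) → ℂ),
      ∫⁻ y : Fin k → ℝ, ‖poleSum lam φ fun j => -t - y j * Complex.I‖ₑ ^ 2 ≤
        ENNReal.ofReal q ^ k * ∫⁻ y : Fin k → ℝ, ‖poleSum lam φ fun j => -(y j * Complex.I)‖ₑ ^ 2 := by
  obtain ⟨δ, hδ, h⟩ := exists_lintegral_shift_le hinj hre hq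
  refine ⟨δ, hδ, fun t ht k φ => ?_⟩
  refine lintegral_enorm_sq_le_pow (P := fun k F => ∃ φ : (Fin k → Fin r) → ℂ, F = poleSum lam φ)
    (𝒜 := {a | ∃ u : ℂ, ‖u‖ < δ ∧ a = fun y : ℝ => (-u - y * Complex.I : ℂ)})
    (b := fun y => -(y * Complex.I)) ⟨0, by simpa using hδ, by simp⟩ ENNReal.ofReal_ne_top
    ?_ ?_ ?_ k _ ⟨φ, rfl⟩ (fun _ y => -t - y * Complex.I) fun _ => ⟨t, ht, rfl⟩
  · rintro k _ ⟨φ, rfl⟩ y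
    exact ⟨_, funext fun s => poleSum_snoc' lam φ s _⟩
  · rintro k _ ⟨φ, rfl⟩ _ ⟨u, hu, rfl⟩ a' _ y
    simp only [poleSum_snoc]
    exact h u hu _
  · rintro k _ ⟨φ, rfl⟩ a ha
    choose u _ ha using ha
    simp only [ha, poleSum]
    fun_prop

end SimpleFractions

/-! ### Inner products as residue pairings -/

/-- The `L²` inner product on the imaginary axes. -/
noncomputable def axisInner {k : ℕ} (F G : (Fin k → ℂ) → ℂ) : ℂ :=
  (((2 * Real.pi) ^ k)⁻¹ : ℝ) * ∫ y : Fin k → ℝ, (F fun j => y j * Complex.I) *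
    (starRingEnd ℂ) (G fun j => y j * Complex.I)

section AxisInner

variable {k : ℕ} {F G : (Fin k → ℂ) → ℂ}

theorem axisInner_self (F : (Fin k → ℂ) → ℂ) : axisInner F F = axisNormSq F := by
  have h : ∀ y : Fin k → ℝ, (F fun j => y j * Complex.I) *
      (starRingEnd ℂ) (F fun j => y j * Complex.I) = ((‖F fun j => y j * Complex.I‖ ^ 2 : ℝ) : ℂ) :=
    fun y => by rw [Complex.mul_conj, Complex.normSq_eq_norm_sq]
  simp_rw [axisInner, h]
  rw [integral_complex_ofReal, axisNormSq]
  push_cast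
  rfl

theorem IsHardy.integrable_mul_conj (hF : IsHardy F) (hG : IsHardy G) :
    Integrable (fun y : Fin k → ℝ => (F fun j => y j * Complex.I) *
      (starRingEnd ℂ) (G fun j => y j * Complex.I)) := by
  obtain ⟨C, hC⟩ := hG.bound
  refine hF.integrable_mul (D := C) (Complex.continuous_conj.comp hG.continuous_axis) fun y => ?_
  simpa using hC (fun j => y j * Complex.I) (by simp)

theorem IsHardy.axisNormSq_sub (hF : IsHardy F) (hG : IsHardy G) :
    axisNormSq (F - G) = axisNormSq F - 2 * (axisInner F G).re + axisNormSq G := by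
  have hre : (axisInner F G).re = ((2 * Real.pi) ^ k)⁻¹ * ∫ y : Fin k → ℝ,
      ((F fun j => y j * Complex.I) * (starRingEnd ℂ) (G fun j => y j * Complex.I)).re := by
    have h1 : ∀ y : Fin k → ℝ, ((F fun j => y j * Complex.I) *
        (starRingEnd ℂ) (G fun j => y j * Complex.I)).re = RCLike.re ((F fun j => y j * Complex.I) *
        (starRingEnd ℂ) (G fun j => y j * Complex.I)) := fun y => rfl
    simp_rw [h1]
    rw [integral_re (hF.integrable_mul_conj hG), axisInner]
    rw [Complex.re_ofReal_mul]
    rfl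
  have hint : Integrable (fun y : Fin k → ℝ => ((F fun j => y j * Complex.I) *
      (starRingEnd ℂ) (G fun j => y j * Complex.I)).re) := (hF.integrable_mul_conj hG).re
  have h3 : ∀ y : Fin k → ℝ, ‖(F - G) fun j => y j * Complex.I‖ ^ 2 =
      ‖F fun j => y j * Complex.I‖ ^ 2 - 2 * ((F fun j => y j * Complex.I) *
        (starRingEnd ℂ) (G fun j => y j * Complex.I)).re + ‖G fun j => y j * Complex.I‖ ^ 2 := by
    intro y
    rw [Pi.sub_apply, ← Complex.normSq_eq_norm_sq, Complex.normSq_sub, Complex.normSq_eq_norm_sq,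
      Complex.normSq_eq_norm_sq]
    ring
  rw [hre, axisNormSq, axisNormSq, axisNormSq]
  simp_rw [h3]
  have h4 := integral_add (hF.integrable_norm_sq.sub (hint.const_mul 2)) hG.integrable_norm_sq
  simp only [Pi.sub_apply] at h4
  rw [h4, integral_sub hF.integrable_norm_sq (hint.const_mul 2), integral_const_mul]
  ring

/-- The reflection y ↦ -y conjugates the integrand. -/
theorem axisInner_im_eq_zero
    (hF : ∀ s, F (fun j => (starRingEnd ℂ) (s j)) = (starRingEnd ℂ) (F s))
    (hG : ∀ s, G (fun j => (starRingEnd ℂ) (s j)) = (starRingEnd ℂ) (G s)) :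
    (axisInner F G).im = 0 := by
  rw [← Complex.conj_eq_iff_im, axisInner, map_mul, ← integral_conj]
  congr 1
  · exact Complex.conj_ofReal _
  · rw [← integral_neg_eq_self]
    congr 1
    ext y
    have h : (fun j => (((-y) j : ℝ) : ℂ) * Complex.I) =
        fun j => (starRingEnd ℂ) ((y j : ℂ) * Complex.I) := by
      ext j
      simp
    rw [h, hF, hG]
    simp

/-- The Cauchy formula at the points -λₗ - t: their Cauchy kernels are exactly the fractions of the
pole sum evaluated at -t - iy. -/
theorem IsHardy.sum_mul_apply_eq_integral {r : ℕ} (hF : IsHardy F) {lam : Fin r → ℂ} {t : ℂ}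
    (ht : ∀ i, 0 < (-lam i - t).re) (φ : (Fin k → Fin r) → ℂ) :
    ∑ l, φ l * F (fun j => -lam (l j) - t) = (((2 * Real.pi) ^ k)⁻¹ : ℝ) *
      ∫ y : Fin k → ℝ, (F fun j => y j * Complex.I) *
        poleSum lam φ fun j => -t - y j * Complex.I := by
  have h1 : ∀ y : Fin k → ℝ, (F fun j => y j * Complex.I) *
      poleSum lam φ (fun j => -t - y j * Complex.I) = ∑ l, φ l * ((F fun j => y j * Complex.I) *
        ∏ j, (-lam (l j) - t - y j * Complex.I)⁻¹) := by
    intro y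
    rw [poleSum, Finset.mul_sum]
    refine Finset.sum_congr rfl fun l _ => ?_
    have h2 : ∀ j, -t - y j * Complex.I - lam (l j) = -lam (l j) - t - y j * Complex.I :=
      fun j => by ring
    simp_rw [h2]
    ring
  simp_rw [h1]
  rw [integral_finsetSum _ fun l _ =>
    (hF.integrable_mul_prod_inv_sub (μ := fun j => -lam (l j) - t) fun j => ht _).const_mul _,
    Finset.mul_sum]
  refine Finset.sum_congr rfl fun l _ => ?_
  rw [integral_const_mul, hF.integral_mul_prod_inv_sub (μ := fun j => -lam (l j) - t) fun j => ht _]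
  have : (2 * Real.pi : ℂ) ^ k ≠ 0 := by simp [Real.pi_ne_zero]
  push_cast
  field_simp

end AxisInner

/-- The chain rule in the direction (-1, …, -1): a common shift of all variables is the source of
the sum over j in the second optimality condition. -/
theorem hasDerivAt_comp_sub_const {k : ℕ} {F : (Fin k → ℂ) → ℂ} {s : Fin k → ℂ}
    (hF : DifferentiableAt ℂ F s) :
    HasDerivAt (fun t : ℂ => F fun j => s j - t) (-∑ j, partialDeriv F j s) 0 := by
  have h1 : ∀ j, partialDeriv F j s = fderiv ℂ F s (Pi.single j 1) := by
    intro j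
    have h2 : HasFDerivAt F (fderiv ℂ F s) (Function.update s j (s j)) := by
      rw [Function.update_eq_self]
      exact hF.hasFDerivAt
    exact (h2.comp_hasDerivAt (s j) (hasDerivAt_update s j (s j))).deriv
  have h3 : HasDerivAt (fun t : ℂ => fun j => s j - t) (fun _ => (-1 : ℂ)) 0 :=
    hasDerivAt_pi.2 fun j => by simpa using (hasDerivAt_id (0 : ℂ)).const_sub (s j)
  have h4 : HasFDerivAt F (fderiv ℂ F s) (fun j => s j - 0) := by simpa using hF.hasFDerivAt
  have h5 := h4.comp_hasDerivAt (0 : ℂ) h3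
  have h6 : -∑ j, partialDeriv F j s = (fderiv ℂ F s) fun _ => -1 := by
    simp_rw [h1]
    rw [← map_sum, ← map_neg]
    congr 1
    ext i
    simp [Finset.sum_apply, Pi.single_apply]
  rw [h6]
  exact h5

/-! ### Energies, pairings and a summable majorant -/

namespace BilinearSystem

variable {n r : ℕ}

/-- The pairing of the transfer function of `ζ` with the residues of `ζr`, at the mirror images of
the poles of `ζr` shifted by `t`. -/
noncomputable def residuePairing (ζ : BilinearSystem n) (ζr : BilinearSystem r) (lam : Fin r → ℂ)
    (k : ℕ) (t : ℂ) : ℂ :=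
  ∑ l, ζr.transferCoeff lam k l * ζ.transfer k fun j => -lam (l j) - t

variable {ζ : BilinearSystem n} {ζr : BilinearSystem r} {lam : Fin r → ℂ}

theorem IsStable.re_lt_zero (hζr : ζr.IsStable) (hlam : ζr.HasSimplePoles lam) (i : Fin r) :
    (lam i).re < 0 :=
  hζr _ ((hlam.isRoot_iff _).2 ⟨i, rfl⟩)

theorem HasSimplePoles.isStable_perturb (hlam : ζr.HasSimplePoles lam) {t : ℝ}
    (ht : ∀ i, 0 < (-lam i - t).re) (κ : ℝ) : (ζr.perturb t κ).IsStable := by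
  refine ζr.isStable_perturb (fun z hz => ?_) κ
  obtain ⟨i, rfl⟩ := (hlam.isRoot_iff _).1 hz
  have := ht i
  simp at this
  linarith

theorem HasSimplePoles.conj_transfer_perturb (hlam : ζr.HasSimplePoles lam) {t : ℝ}
    (ht : ∀ i, 0 < (-lam i - t).re) (κ : ℝ) (k : ℕ) (y : Fin (k + 1) → ℝ) :
    (starRingEnd ℂ) ((ζr.perturb t κ).transfer k fun j => y j * Complex.I) =
      (1 + κ) * poleSum lam (ζr.transferCoeff lam k) fun j => -t - y j * Complex.I := by
  rw [← transfer_conj, transfer_perturb, hlam.transfer_eq]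
  · congr 2
    ext j
    simp
    ring
  · intro j i h
    have h1 := congrArg Complex.re h
    have h2 := ht i
    simp at h1 h2
    linarith

theorem axisInner_transfer_perturb (hζ : ζ.IsStable) (hlam : ζr.HasSimplePoles lam) {t : ℝ}
    (ht : ∀ i, 0 < (-lam i - t).re) (κ : ℝ) (k : ℕ) :
    axisInner (ζ.transfer k) ((ζr.perturb t κ).transfer k) =
      (1 + κ) * ζ.residuePairing ζr lam k t := by
  rw [residuePairing, (hζ.isHardy_transfer k).sum_mul_apply_eq_integral ht, axisInner]
  simp_rw [hlam.conj_transfer_perturb ht, mul_left_comm _ (1 + (κ : ℂ))]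
  rw [integral_const_mul]
  ring

theorem residuePairing_im (hζ : ζ.IsStable) (hlam : ζr.HasSimplePoles lam) {t : ℝ}
    (ht : ∀ i, 0 < (-lam i - t).re) (k : ℕ) : (ζ.residuePairing ζr lam k t).im = 0 := by
  have h := axisInner_transfer_perturb hζ hlam ht 0 k
  rw [Complex.ofReal_zero, add_zero, one_mul] at h
  rw [← h]
  exact axisInner_im_eq_zero (ζ.transfer_conj k) ((ζr.perturb t 0).transfer_conj k)

/-- Pairing the perturbed system with itself shifts twice: once through the evaluation points -λₗ -
t and once through the arguments of the perturbed transfer function. Hence `2 * t`. -/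
theorem axisNormSq_transfer_perturb (hlam : ζr.HasSimplePoles lam) {t : ℝ}
    (ht : ∀ i, 0 < (-lam i - t).re) (κ : ℝ) (k : ℕ) :
    (axisNormSq ((ζr.perturb t κ).transfer k) : ℂ) =
      (1 + κ) ^ 2 * ζr.residuePairing ζr lam k (2 * t) := by
  rw [← axisInner_self, axisInner_transfer_perturb (hlam.isStable_perturb ht κ) hlam ht,
    residuePairing, residuePairing, Finset.mul_sum, Finset.mul_sum]
  refine Finset.sum_congr rfl fun l _ => ?_
  rw [transfer_perturb]
  have : (fun j => -lam (l j) - (t : ℂ) - t) = fun j => -lam (l j) - 2 * t := by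
    ext j
    ring
  rw [this]
  ring

theorem axisNormSq_transfer (hζr : ζr.IsStable) (hlam : ζr.HasSimplePoles lam) (k : ℕ) :
    (axisNormSq (ζr.transfer k) : ℂ) = ζr.residuePairing ζr lam k 0 := by
  have h := axisNormSq_transfer_perturb hlam (t := 0) (by simpa using hζr.re_lt_zero hlam) 0 k
  simpa [perturb_zero] using h

theorem axisNormSq_sub_perturb (hζ : ζ.IsStable) (hlam : ζr.HasSimplePoles lam) {t : ℝ}
    (ht : ∀ i, 0 < (-lam i - t).re) (κ : ℝ) (k : ℕ) :
    axisNormSq ((ζ.transfer - (ζr.perturb t κ).transfer) k) = axisNormSq (ζ.transfer k) -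
      2 * (1 + κ) * (ζ.residuePairing ζr lam k t).re +
      (1 + κ) ^ 2 * (ζr.residuePairing ζr lam k (2 * t)).re := by
  have h1 := axisInner_transfer_perturb hζ hlam ht κ k
  have h2 := congrArg Complex.re (axisNormSq_transfer_perturb hlam ht κ k)
  have e1 : (1 + (κ : ℂ)) = ((1 + κ : ℝ) : ℂ) := by push_cast; rfl
  have e2 : (1 + (κ : ℂ)) ^ 2 = (((1 + κ) ^ 2 : ℝ) : ℂ) := by push_cast; rfl
  rw [e2, Complex.ofReal_re, Complex.re_ofReal_mul] at h2
  rw [Pi.sub_apply,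
    (hζ.isHardy_transfer k).axisNormSq_sub ((hlam.isStable_perturb ht κ).isHardy_transfer k), h1, h2,
    e1, Complex.re_ofReal_mul]
  ring

/-- The energies of the transfer functions decay geometrically when their sum is finite. -/
theorem exists_axisNormSq_le (hζr : ζr.IsStable) (hlam : ζr.HasSimplePoles lam)
    (hsum : Summable fun k => axisNormSq (ζr.transfer k)) :
    ∃ C ρ : ℝ, 0 < ρ ∧ ρ < 1 ∧ ∀ k, axisNormSq (ζr.transfer k) ≤ C * ρ ^ k := by
  set c : Fin r → ℂ := fun i => (ζr.c i : ℂ) with hc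
  set ℓ : Matrix (Fin r) (Fin r) ℂ →ₗ[ℂ] ℂ :=
    { toFun := fun X => c ⬝ᵥ (X *ᵥ c)
      map_add' := fun X Y => by rw [Matrix.add_mulVec, dotProduct_add]
      map_smul' := fun a X => by rw [Matrix.smul_mulVec, dotProduct_smul]; rfl } with hℓ
  set X₀ := ∑ l, Matrix.vecMulVec (ζr.stateCoeff lam 0 l) (ζr.inputToState 0 fun j => -lam (l j))
  have h1 : ∀ k, ℓ ((ζr.gramStep lam ^ k) X₀) = axisNormSq (ζr.transfer k) := by
    intro k
    rw [axisNormSq_transfer hζr hlam, residuePairing]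
    simp only [sub_zero]
    exact (ζr.sum_transferCoeff_mul_transfer lam k).symm
  have h2 : Tendsto (fun k => ℓ ((ζr.gramStep lam ^ k) X₀)) atTop (𝓝 0) := by
    simp_rw [h1]
    exact (Complex.continuous_ofReal.tendsto' 0 0 rfl).comp hsum.tendsto_atTop_zero
  -- The energies are the outputs cᵀ X c of the recursion `gramStep`, and they tend to 0 by
  -- summability.
  obtain ⟨C, ρ, hρ0, hρ1, h⟩ := exists_geometric_bound _ ℓ X₀ h2
  refine ⟨C, ρ, hρ0, hρ1, fun k => ?_⟩
  have h3 := h k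
  rwa [h1, Complex.norm_real, Real.norm_of_nonneg (axisNormSq_nonneg _)] at h3

/-- The Cauchy formula writes the pairing as an integral of Hₖ against the shifted pole sum, and
|ab| ≤ |a|² + |b|² separates the two. The hypothesis `hle` compares the shifted pole sum with the
unshifted one, which on the axes has the modulus of H̃ₖ. -/
theorem norm_residuePairing_le (hζ : ζ.IsStable) (hζr : ζr.IsStable) (hlam : ζr.HasSimplePoles lam)
    {q : ℝ} (hq : 0 ≤ q) {t : ℂ} (ht : ∀ i, 0 < (-lam i - t).re) (k : ℕ)
    (hle : ∫⁻ y : Fin (k + 1) → ℝ,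
        ‖poleSum lam (ζr.transferCoeff lam k) fun j => -t - y j * Complex.I‖ₑ ^ 2 ≤
      ENNReal.ofReal q ^ (k + 1) * ∫⁻ y : Fin (k + 1) → ℝ,
        ‖poleSum lam (ζr.transferCoeff lam k) fun j => -(y j * Complex.I)‖ₑ ^ 2) :
    ‖ζ.residuePairing ζr lam k t‖ ≤
      axisNormSq (ζ.transfer k) + q ^ (k + 1) * axisNormSq (ζr.transfer k) := by
  have hF := hζ.isHardy_transfer k
  have hG := hζr.isHardy_transfer k
  set G : (Fin (k + 1) → ℝ) → ℂ :=
    fun y => poleSum lam (ζr.transferCoeff lam k) fun j => -t - y j * Complex.I with hGdef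
  have hGm : Measurable G := by
    simp only [hGdef, poleSum]
    fun_prop
  have h1 : ∀ y : Fin (k + 1) → ℝ, ‖poleSum lam (ζr.transferCoeff lam k)
      fun j => -(y j * Complex.I)‖ₑ = ‖ζr.transfer k fun j => y j * Complex.I‖ₑ := by
    intro y
    rw [← hlam.transfer_eq]
    · have : (fun j => -(y j * Complex.I)) = fun j => (starRingEnd ℂ) (y j * Complex.I) := by
        ext j
        simp
      rw [this, transfer_conj]
      simp [enorm_eq_nnnorm]
    · intro j i h
      have h2 := congrArg Complex.re h
      have h3 := hζr.re_lt_zero hlam i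
      simp at h2
      linarith
  simp_rw [h1] at hle
  rw [hG.lintegral_enorm_sq, ← ENNReal.ofReal_pow hq, ← ENNReal.ofReal_mul (by positivity)] at hle
  have h2 : ∫⁻ y, ENNReal.ofReal (‖G y‖ ^ 2) = ∫⁻ y, ‖G y‖ₑ ^ 2 := by
    refine lintegral_congr fun y => ?_
    rw [ENNReal.ofReal_pow (norm_nonneg _), ofReal_norm]
  have hGi : Integrable fun y => ‖G y‖ ^ 2 := by
    refine ⟨(hGm.norm.pow_const 2).aestronglyMeasurable, ?_⟩
    rw [hasFiniteIntegral_iff_ofReal (ae_of_all _ fun y => by positivity), h2]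
    exact hle.trans_lt ENNReal.ofReal_lt_top
  have hGle : ∫ y, ‖G y‖ ^ 2 ≤ q ^ (k + 1) *
      ∫ y : Fin (k + 1) → ℝ, ‖ζr.transfer k fun j => y j * Complex.I‖ ^ 2 := by
    rw [← ENNReal.ofReal_le_ofReal_iff (mul_nonneg (by positivity)
      (integral_nonneg fun _ => by positivity)),
      ofReal_integral_eq_lintegral_ofReal hGi (ae_of_all _ fun y => by positivity), h2]
    exact hle
  rw [residuePairing, hF.sum_mul_apply_eq_integral ht, norm_mul]
  have hpi : ‖((((2 * Real.pi) ^ (k + 1))⁻¹ : ℝ) : ℂ)‖ = ((2 * Real.pi) ^ (k + 1))⁻¹ := by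
    rw [Complex.norm_real, Real.norm_of_nonneg (by positivity)]
  have h3 : ‖∫ y : Fin (k + 1) → ℝ, (ζ.transfer k fun j => y j * Complex.I) * G y‖ ≤
      ∫ y : Fin (k + 1) → ℝ, (‖ζ.transfer k fun j => y j * Complex.I‖ ^ 2 + ‖G y‖ ^ 2) := by
    refine norm_integral_le_of_norm_le (hF.integrable_norm_sq.add hGi) (ae_of_all _ fun y => ?_)
    rw [norm_mul]
    nlinarith [sq_nonneg (‖ζ.transfer k fun j => y j * Complex.I‖ - ‖G y‖),
      sq_nonneg (‖ζ.transfer k fun j => y j * Complex.I‖), sq_nonneg ‖G y‖]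
  rw [integral_add hF.integrable_norm_sq hGi] at h3
  rw [hpi, axisNormSq, axisNormSq]
  calc _ ≤ ((2 * Real.pi) ^ (k + 1))⁻¹ *
        ((∫ y : Fin (k + 1) → ℝ, ‖ζ.transfer k fun j => y j * Complex.I‖ ^ 2) + q ^ (k + 1) *
          ∫ y : Fin (k + 1) → ℝ, ‖ζr.transfer k fun j => y j * Complex.I‖ ^ 2) := by
        gcongr
        exact h3.trans (by gcongr)
    _ = _ := by ring

/-- The cost `q ^ (k + 1)` of a shift is beaten by the decay `ρ ^ k` of the energies. Complex shifts
are included because termwise differentiation will rest on holomorphy. -/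
theorem exists_summable_bound (hζ : ζ.IsStable) (hζr : ζr.IsStable) (hlam : ζr.HasSimplePoles lam)
    (hsum : Summable fun k => axisNormSq (ζ.transfer k))
    (hsumr : Summable fun k => axisNormSq (ζr.transfer k)) :
    ∃ δ > 0, ∃ u : ℕ → ℝ, Summable u ∧ ∀ t : ℂ, ‖t‖ < δ → (∀ i, 0 < (-lam i - t).re) ∧
      ∀ k, ‖ζ.residuePairing ζr lam k t‖ ≤ u k := by
  obtain ⟨C, ρ, hρ0, hρ1, hC⟩ := exists_axisNormSq_le hζr hlam hsumr
  -- Any `q` between 1 and `ρ⁻¹` serves: it exceeds 1, so small shifts are allowed, and `q * ρ < 1`.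
  obtain ⟨q, hq1, hq⟩ := exists_between (one_lt_inv₀ hρ0 |>.2 hρ1)
  have hq0 : 0 < q := by linarith
  have hre := hζr.re_lt_zero hlam
  obtain ⟨δ, hδ, hshift⟩ := exists_lintegral_poleSum_shift_le hlam.1 hre hq1
  have hev : ∀ᶠ t : ℂ in 𝓝 0, ∀ i, 0 < (-lam i - t).re := by
    refine eventually_all.2 fun i => ?_
    have hc : Continuous fun t : ℂ => (-lam i - t).re := by fun_prop
    exact (hc.tendsto 0).eventually_const_lt (by simpa using hre i)
  obtain ⟨ε, hε, hball⟩ := Metric.eventually_nhds_iff.1 hev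
  refine ⟨min δ ε, lt_min hδ hε,
    fun k => axisNormSq (ζ.transfer k) + q ^ (k + 1) * axisNormSq (ζr.transfer k), ?_, ?_⟩
  · refine hsum.add ?_
    have hqρ : q * ρ < 1 := by
      have := mul_lt_mul_of_pos_right hq hρ0
      rwa [inv_mul_cancel₀ hρ0.ne'] at this
    refine Summable.of_nonneg_of_le (fun k => mul_nonneg (by positivity) (axisNormSq_nonneg _))
      (fun k => ?_) ((summable_geometric_of_lt_one (by positivity) hqρ).mul_left (q * C))
    calc q ^ (k + 1) * axisNormSq (ζr.transfer k) ≤ q ^ (k + 1) * (C * ρ ^ k) := by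
          gcongr
          exact hC k
      _ = _ := by ring
  · intro t ht
    have ht' := hball (y := t) (by simpa using ht.trans_le (min_le_right _ _))
    exact ⟨ht', fun k => norm_residuePairing_le hζ hζr hlam hq0.le ht' k
      (hshift t (ht.trans_le (min_le_left _ _)) _ _)⟩

theorem IsStable.differentiableAt_residuePairing (hζ : ζ.IsStable) (k : ℕ) {t : ℂ}
    (ht : ∀ i, 0 < (-lam i - t).re) : DifferentiableAt ℂ (ζ.residuePairing ζr lam k) t := by
  refine DifferentiableAt.fun_sum fun l _ => DifferentiableAt.const_mul ?_ _
  refine DifferentiableAt.comp (f := fun t : ℂ => fun j => -lam (l j) - t) t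
    ((hζ.isHardy_transfer k).differentiableAt _ fun j => (ht _).le) ?_
  fun_prop

theorem IsStable.deriv_residuePairing (hζ : ζ.IsStable) (hre : ∀ i, (lam i).re < 0) (k : ℕ) :
    deriv (ζ.residuePairing ζr lam k) 0 = -∑ l, ζr.transferCoeff lam k l *
      ∑ j, partialDeriv (ζ.transfer k) j fun i => -lam (l i) := by
  have h : HasDerivAt (ζ.residuePairing ζr lam k) (∑ l, ζr.transferCoeff lam k l *
      -∑ j, partialDeriv (ζ.transfer k) j fun i => -lam (l i)) 0 := by
    refine HasDerivAt.fun_sum fun l _ => HasDerivAt.const_mul _ ?_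
    exact hasDerivAt_comp_sub_const (s := fun i => -lam (l i))
      ((hζ.isHardy_transfer k).differentiableAt _ fun j => by simpa using (hre _).le)
  rw [h.deriv]
  simp

end BilinearSystem

theorem HasDerivAt.re_ofReal {f : ℂ → ℂ} {f' : ℂ} {x : ℝ} (hf : HasDerivAt f f' x) :
    HasDerivAt (fun t : ℝ => (f t).re) f'.re x :=
  Complex.reCLM.hasFDerivAt.comp_hasDerivAt x hf.comp_ofReal

theorem HasDerivAt.im_ofReal {f : ℂ → ℂ} {f' : ℂ} {x : ℝ} (hf : HasDerivAt f f' x) :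
    HasDerivAt (fun t : ℝ => (f t).im) f'.im x :=
  Complex.imCLM.hasFDerivAt.comp_hasDerivAt x hf.comp_ofReal

/-! ### Stationarity at a local optimum -/

namespace BilinearSystem

variable {n r : ℕ} {ζ : BilinearSystem n} {ζr : BilinearSystem r} {lam : Fin r → ℂ}

/-- The sum over all orders of the residue pairings, as a holomorphic function of the shift. -/
structure IsPairingSum (ζ : BilinearSystem n) (ζr : BilinearSystem r) (lam : Fin r → ℂ)
    (δ : ℝ) (Φ : ℂ → ℂ) : Prop where
  hasSum : ∀ t : ℂ, ‖t‖ < δ → HasSum (fun k => ζ.residuePairing ζr lam k t) (Φ t)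
  differentiableAt : DifferentiableAt ℂ Φ 0
  hasSum_deriv : HasSum (fun k => deriv (ζ.residuePairing ζr lam k) 0) (deriv Φ 0)
  im_eq_zero : ∀ t : ℝ, |t| < δ → (Φ t).im = 0
  pole : ∀ t : ℂ, ‖t‖ < δ → ∀ i, 0 < (-lam i - t).re

theorem exists_isPairingSum (hζ : ζ.IsStable) (hζr : ζr.IsStable) (hlam : ζr.HasSimplePoles lam)
    (hsum : Summable fun k => axisNormSq (ζ.transfer k))
    (hsumr : Summable fun k => axisNormSq (ζr.transfer k)) :
    ∃ δ > 0, ∃ Φ, IsPairingSum ζ ζr lam δ Φ := by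
  obtain ⟨δ, hδ, u, hu, h⟩ := exists_summable_bound hζ hζr hlam hsum hsumr
  have hmem : ∀ t : ℂ, t ∈ Metric.ball (0 : ℂ) δ ↔ ‖t‖ < δ := fun t => by simp
  have hd : ∀ k, DifferentiableOn ℂ (ζ.residuePairing ζr lam k) (Metric.ball 0 δ) :=
    fun k t ht => (hζ.differentiableAt_residuePairing k
      (h t ((hmem t).1 ht)).1).differentiableWithinAt
  have hb : ∀ k, ∀ t ∈ Metric.ball (0 : ℂ) δ, ‖ζ.residuePairing ζr lam k t‖ ≤ u k :=
    fun k t ht => (h t ((hmem t).1 ht)).2 k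
  have hs : ∀ t : ℂ, ‖t‖ < δ → HasSum (fun k => ζ.residuePairing ζr lam k t)
      (∑' k, ζ.residuePairing ζr lam k t) :=
    fun t ht => (Summable.of_norm_bounded hu (h t ht).2).hasSum
  refine ⟨δ, hδ, fun t => ∑' k, ζ.residuePairing ζr lam k t, hs, ?_, ?_, ?_, fun t ht => (h t ht).1⟩
  · exact (Complex.differentiableOn_tsum_of_summable_norm hu hd Metric.isOpen_ball hb).differentiableAt
      (Metric.ball_mem_nhds 0 hδ)
  · exact Complex.hasSum_deriv_of_summable_norm hu hd Metric.isOpen_ball hb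
      (Metric.mem_ball_self hδ)
  · intro t ht
    have ht' : ‖(t : ℂ)‖ < δ := by simpa using ht
    have h1 := Complex.hasSum_im (hs t ht')
    simp only [residuePairing_im hζ hlam (h t ht').1] at h1
    exact h1.unique hasSum_zero

theorem IsPairingSum.im_deriv_eq_zero {δ : ℝ} (hδ : 0 < δ) {Φ : ℂ → ℂ}
    (h : IsPairingSum ζ ζr lam δ Φ) : (deriv Φ 0).im = 0 := by
  have h1 : HasDerivAt Φ (deriv Φ 0) ((0 : ℝ) : ℂ) := by simpa using h.differentiableAt.hasDerivAt
  have h2 : (fun t : ℝ => (Φ t).im) =ᶠ[𝓝 0] fun _ => 0 := by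
    refine Metric.eventually_nhds_iff.2 ⟨δ, hδ, fun t ht => h.im_eq_zero t ?_⟩
    simpa using ht
  exact h1.im_ofReal.unique ((hasDerivAt_const (0 : ℝ) (0 : ℝ)).congr_of_eventuallyEq h2)

/-- Near a local optimum, the squared error as a function of the perturbation. -/
theorem eventually_error_le (hζ : ζ.IsStable) (hζfin : h2Norm ζ.transfer < ⊤) (hζr : ζr.IsStable)
    (hlam : ζr.HasSimplePoles lam) (hopt : IsLocallyH2Optimal ζ ζr) {δ δ' : ℝ} (hδ : 0 < δ)
    (hδ' : 0 < δ') {Φ Ψ : ℂ → ℂ} (hΦ : IsPairingSum ζ ζr lam δ Φ) (hΨ : IsPairingSum ζr ζr lam δ' Ψ) :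
    ∀ᶠ p : ℝ × ℝ in 𝓝 (0, 0), -2 * (Φ 0).re + (Ψ 0).re ≤
      -2 * (1 + p.2) * (Φ p.1).re + (1 + p.2) ^ 2 * (Ψ (2 * p.1)).re := by
  have hsum := (h2Norm_lt_top_iff hζ.isHardy_transfer).1 hζfin
  -- Convergence of the pairing sums at `t` and `2 * t` also shows that the perturbed system has
  -- finite norm, hence is an admissible competitor.
  have herr : ∀ p : ℝ × ℝ, |p.1| < δ → |2 * p.1| < δ' →
      (ζr.perturb p.1 p.2).IsStable ∧ HasSum
        (fun k => axisNormSq ((ζ.transfer - (ζr.perturb p.1 p.2).transfer) k))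
        (∑' k, axisNormSq (ζ.transfer k) - 2 * (1 + p.2) * (Φ p.1).re +
          (1 + p.2) ^ 2 * (Ψ (2 * p.1)).re) ∧ h2Norm (ζr.perturb p.1 p.2).transfer < ⊤ := by
    rintro ⟨t, κ⟩ h1 h2
    simp only at h1 h2 ⊢
    have ht : ‖(t : ℂ)‖ < δ := by simpa using h1
    have ht2 : ‖(2 * t : ℂ)‖ < δ' := by simpa [abs_mul] using h2
    have hp := hΦ.pole _ ht
    have hst := hlam.isStable_perturb hp κ
    have hΨs := Complex.hasSum_re (hΨ.hasSum _ ht2)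
    refine ⟨hst, ?_, ?_⟩
    · simp_rw [axisNormSq_sub_perturb hζ hlam hp κ]
      exact (hsum.hasSum.sub ((Complex.hasSum_re (hΦ.hasSum _ ht)).mul_left _)).add (hΨs.mul_left _)
    · rw [h2Norm_lt_top_iff hst.isHardy_transfer]
      have h3 : ∀ k, axisNormSq ((ζr.perturb t κ).transfer k) =
          (1 + κ) ^ 2 * (ζr.residuePairing ζr lam k (2 * t)).re := fun k => by
        have h4 := congrArg Complex.re (axisNormSq_transfer_perturb hlam hp κ k)
        have e2 : (1 + (κ : ℂ)) ^ 2 = (((1 + κ) ^ 2 : ℝ) : ℂ) := by push_cast; rfl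
        rwa [e2, Complex.ofReal_re, Complex.re_ofReal_mul] at h4
      simp_rw [h3]
      exact hΨs.summable.mul_left _
  have hloc := hopt.2
  rw [IsLocalMinOn, IsMinFilter, eventually_nhdsWithin_iff] at hloc
  have hcont : Tendsto (fun p : ℝ × ℝ => ζr.perturb p.1 p.2) (𝓝 (0, 0)) (𝓝 ζr) := by
    have := ζr.continuous_perturb.tendsto (0, 0)
    rwa [perturb_zero] at this
  have hsm1 : ∀ᶠ p : ℝ × ℝ in 𝓝 (0, 0), |p.1| < δ := by
    have hc : Continuous fun p : ℝ × ℝ => |p.1| := by fun_prop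
    exact (hc.tendsto (0, 0)).eventually_lt_const (by simpa using hδ)
  have hsm2 : ∀ᶠ p : ℝ × ℝ in 𝓝 (0, 0), |2 * p.1| < δ' := by
    have hc : Continuous fun p : ℝ × ℝ => |2 * p.1| := by fun_prop
    exact (hc.tendsto (0, 0)).eventually_lt_const (by simpa using hδ')
  filter_upwards [hcont.eventually hloc, hsm1, hsm2] with p hp h1 h2
  obtain ⟨hst, hS, hfin⟩ := herr p h1 h2
  obtain ⟨-, hS0, -⟩ := herr (0, 0) (by simpa using hδ) (by simpa using hδ')
  have hle := hp hfin
  simp only [perturb_zero] at hS0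
  replace hle := (h2Norm_le_iff (F := ζ.transfer - ζr.transfer)
    (G := ζ.transfer - (ζr.perturb p.1 p.2).transfer)
    (fun k => (hζ.isHardy_transfer k).sub (hζr.isHardy_transfer k))
    (fun k => (hζ.isHardy_transfer k).sub (hst.isHardy_transfer k)) hS0.summable hS.summable).1 hle
  rw [hS0.tsum_eq, hS.tsum_eq] at hle
  simp only [Complex.ofReal_zero, mul_zero, add_zero, mul_one, one_pow, one_mul] at hle
  linarith

/-- Fermat's theorem along the two coordinate axes: κ at t = 0 gives -2Φ(0) + 2Ψ(0) = 0, and t at κ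
= 0 gives -2Φ'(0) + 2Ψ'(0) = 0, the last 2 coming from the argument 2t. This concerns real parts;
the imaginary parts vanish by reality. -/
theorem pairingSum_eq_of_isLocallyH2Optimal (hζ : ζ.IsStable) (hζfin : h2Norm ζ.transfer < ⊤)
    (hζr : ζr.IsStable) (hlam : ζr.HasSimplePoles lam) (hopt : IsLocallyH2Optimal ζ ζr) {δ δ' : ℝ}
    (hδ : 0 < δ) (hδ' : 0 < δ') {Φ Ψ : ℂ → ℂ} (hΦ : IsPairingSum ζ ζr lam δ Φ)
    (hΨ : IsPairingSum ζr ζr lam δ' Ψ) : Φ 0 = Ψ 0 ∧ deriv Φ 0 = deriv Ψ 0 := by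
  have hev := eventually_error_le hζ hζfin hζr hlam hopt hδ hδ' hΦ hΨ
  constructor
  · have hmin : IsLocalMin (fun κ : ℝ => -2 * (1 + κ) * (Φ 0).re + (1 + κ) ^ 2 * (Ψ 0).re) 0 := by
      have hc : Continuous fun κ : ℝ => ((0 : ℝ), κ) := by fun_prop
      filter_upwards [(hc.tendsto 0).eventually hev] with κ hκ
      simpa using hκ
    have hd : HasDerivAt (fun κ : ℝ => -2 * (1 + κ) * (Φ 0).re + (1 + κ) ^ 2 * (Ψ 0).re)
        (-2 * 1 * (Φ 0).re + (2 : ℕ) * (1 + 0) ^ (2 - 1) * 1 * (Ψ 0).re) 0 := by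
      have h1 : HasDerivAt (fun κ : ℝ => 1 + κ) 1 0 := (hasDerivAt_id 0).const_add 1
      exact ((h1.const_mul (-2)).mul_const _).add ((h1.fun_pow 2).mul_const _)
    have h0 := hmin.hasDerivAt_eq_zero hd
    have h1 := hΦ.im_eq_zero 0 (by simpa using hδ)
    have h2 := hΨ.im_eq_zero 0 (by simpa using hδ')
    rw [Complex.ofReal_zero] at h1 h2
    refine Complex.ext ?_ (h1.trans h2.symm)
    norm_num at h0
    linarith
  · have hmin : IsLocalMin (fun t : ℝ => -2 * (Φ t).re + (Ψ (2 * t)).re) 0 := by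
      have hc : Continuous fun t : ℝ => (t, (0 : ℝ)) := by fun_prop
      filter_upwards [(hc.tendsto 0).eventually hev] with t ht
      simpa using ht
    have h1 : HasDerivAt Φ (deriv Φ 0) ((0 : ℝ) : ℂ) := by
      simpa using hΦ.differentiableAt.hasDerivAt
    have h2 : HasDerivAt (fun t : ℂ => Ψ (2 * t)) (deriv Ψ 0 * 2) ((0 : ℝ) : ℂ) := by
      have h3 : HasDerivAt Ψ (deriv Ψ 0) (2 * ((0 : ℝ) : ℂ)) := by
        simpa using hΨ.differentiableAt.hasDerivAt
      have h4 : HasDerivAt (fun t : ℂ => 2 * t) 2 ((0 : ℝ) : ℂ) := by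
        simpa using (hasDerivAt_id ((0 : ℝ) : ℂ)).const_mul 2
      exact h3.comp _ h4
    have h0 := hmin.hasDerivAt_eq_zero ((h1.re_ofReal.const_mul (-2)).add h2.re_ofReal)
    refine Complex.ext ?_ ((hΦ.im_deriv_eq_zero hδ).trans (hΨ.im_deriv_eq_zero hδ').symm)
    simp at h0
    linarith

end BilinearSystem

/-- `HasSum` in ℂ is unconditional and therefore absolute convergence; a common value `S` for both
series expresses the equality. -/
theorem theorem4p3 (n r : ℕ) (ζ : BilinearSystem n) (ζr : BilinearSystem r) (lam : Fin r → ℂ)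
    (hζ : ζ.IsStable) (hζfin : h2Norm ζ.transfer < ⊤)
    (hζr : ζr.IsStable) (hlam : ζr.HasSimplePoles lam)
    (hopt : IsLocallyH2Optimal ζ ζr) :
    (∃ S : ℂ,
      HasSum (fun k : ℕ => ∑ l : Fin (k + 1) → Fin r,
        ζr.residue lam k l * ζ.transfer k (fun i => -lam (l i))) S ∧
      HasSum (fun k : ℕ => ∑ l : Fin (k + 1) → Fin r,
        ζr.residue lam k l * ζr.transfer k (fun i => -lam (l i))) S) ∧
    (∃ S' : ℂ,
      HasSum (fun k : ℕ => ∑ l : Fin (k + 1) → Fin r,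
        ζr.residue lam k l *
          ∑ j : Fin (k + 1), partialDeriv (ζ.transfer k) j (fun i => -lam (l i))) S' ∧
      HasSum (fun k : ℕ => ∑ l : Fin (k + 1) → Fin r,
        ζr.residue lam k l *
          ∑ j : Fin (k + 1), partialDeriv (ζr.transfer k) j (fun i => -lam (l i))) S') := by

  have hsum := (h2Norm_lt_top_iff hζ.isHardy_transfer).1 hζfin
  have hsumr := (h2Norm_lt_top_iff hζr.isHardy_transfer).1 hopt.1
  obtain ⟨δ, hδ, Φ, hΦ⟩ := BilinearSystem.exists_isPairingSum hζ hζr hlam hsum hsumr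
  obtain ⟨δ', hδ', Ψ, hΨ⟩ := BilinearSystem.exists_isPairingSum hζr hζr hlam hsumr hsumr
  obtain ⟨h0, h1⟩ := BilinearSystem.pairingSum_eq_of_isLocallyH2Optimal hζ hζfin hζr hlam hopt hδ hδ'
    hΦ hΨ
  have hre := hζr.re_lt_zero hlam
  simp only [hlam.residue_eq]
  have hΦ0 := hΦ.hasSum 0 (by simpa using hδ)
  have hΨ0 := hΨ.hasSum 0 (by simpa using hδ')
  -- The points are -λₗ - t, so differentiating in t gives minus the sum of the partial derivatives.
  have hΦ1 := hΦ.hasSum_deriv.neg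
  have hΨ1 := hΨ.hasSum_deriv.neg
  simp only [BilinearSystem.residuePairing, sub_zero] at hΦ0 hΨ0
  simp only [hζ.deriv_residuePairing hre, hζr.deriv_residuePairing hre, neg_neg] at hΦ1 hΨ1
  exact ⟨⟨Φ 0, hΦ0, h0 ▸ hΨ0⟩, ⟨-deriv Φ 0, hΦ1, h1 ▸ hΨ1⟩⟩
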